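/- Let $G$ be a countable group. A \emph{map sequence} for $G$ is a sequence $\Sigma=\{\sigma_i\}_{i\ge1}$ of maps (not necessarily homomorphisms) $\sigma_i:G\to\mathrm{Sym}(m_i)$, $m_i\ge 1$, with $m_i\to\infty$. It is a \emph{sofic approximation} to $G$ if there are subsets $F_1\subset F_2\subset\cdots$ of $G$ with $\bigcup_iF_i=G$ and reals $\epsilon_i\to0$ such that for every $i$ at least $(1-\epsilon_i)m_i$ points $v\in\{1,\dots,m_i\}$ satisfy $\sigma_i(f_1)\sigma_i(f_2)v=\sigma_i(f_1f_2)v$ for all $f_1,f_2\in F_i$ and $\sigma_i(f_1)v\neq\sigma_i(f_2)v$ for all $f_1\ne f_2$ in $F_i$. (The group $G$ is sofic if it has a sofic approximation; if $G$ is infinite, $m_i\to\infty$ is automatic.) A \emph{$G$-system} $(G,X,\mu)$ is a probability space $(X,\mu)$ with a measure-preserving action of $G$. Partitions of $X$ are measurable, ordered and at most countable; empty atoms are allowed. Put $H(\alpha)=-\sum_{i}\mu(A_i)\log\mu(A_i)\in[0,\infty]$ for $\alpha=(A_1,A_2,\dots)$. The partition $\alpha$ is \emph{generating} if every measurable set agrees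 up to a $\mu$-null set with a member of the smallest $G$-invariant $\sigma$-algebra containing the atoms of $\alpha$. A partition $\alpha$ \emph{refines} $\beta$, written $\beta\le\alpha$, if each atom of $\alpha$ is contained, up to a null set, in an atom of $\beta$. For a finite partition $\alpha=(A_1,\dots,A_u)$, a finite $F\subset G$, $\epsilon>0$ and $\sigma:G\to\mathrm{Sym}(m)$, let $\mathcal{AP}(\sigma,\alpha:F,\epsilon)$ be the set of ordered partitions $(B_1,\dots,B_u)$ of $\{1,\dots,m\}$ with $$\sum_{\phi:F\to\{1,\dots,u\}}\Big|\mu\Big(\bigcap_{f\in F}fA_{\phi(f)}\Big)-\frac1m\Big|\bigcap_{f\in F}\sigma(f)B_{\phi(f)}\Big|\Big|\le\epsilon ,$$ and put, with $\log 0=-\infty$, $$H(\Sigma,\alpha:F)=\lim_{\epsilon\to0}\ \limsup_{i\to\infty}\frac1{m_i}\log|\mathcal{AP}(\sigma_i,\alpha:F,\epsilon)| .$$ For an arbitrary partition $\alpha$, let $H(\Sigma,\alpha:F)$ be the infimum of $\lim_{n}H(\Sigma,\alpha_n:F)$ over all chains of $\alpha$, that is, sequences of finite partitions $\alpha_1\le\alpha_2\le\cdots\le\alpha$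 with $\bigvee_n\alpha_n=\alpha$ up to null sets (for which the limit exists). In both cases let $h(\Sigma,\alpha)=\inf_FH(\Sigma,\alpha:F)$ over all finite $F\subset G$. \textbf{Theorem.} Let $G$ be a countable sofic group, $\Sigma$ a sofic approximation to $G$ (with $m_i\to\infty$), and $(G,X,\mu)$ a $G$-system. (1) If $\alpha,\beta$ are generating partitions of $X$ with $H(\alpha)+H(\beta)<\infty$, then $h(\Sigma,\alpha)=h(\Sigma,\beta)$. Moreover, for a finite partition $\alpha$ the two definitions of $h(\Sigma,\alpha)$ (directly, and through chains) agree. (2) Consequently, if $(G,X,\mu)$ has a generating partition of finite entropy, then $h(\Sigma,G,X,\mu):=h(\Sigma,\alpha)$ is the same for every generating $\alpha$ with $H(\alpha)<\infty$ (if there is no such partition, $h(\Sigma,G,X,\mu)$ is undefined); and it is a measure-conjugacy invariant: if $(G,Y,\nu)$ is another $G$-system and there are conull sets $X'\subset X$, $Y'\subset Y$ and a bimeasurable bijection $\phi:X'\to Y'$ with $\phi_*\mu=\nu$ and, for all $g\in G$ and $x\in X'$, $gx\in X'$ and $\phi(gx)=g\phi(x)$, then $h(\Sigma,G,X,\mu)$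 is defined if and only if $h(\Sigma,G,Y,\nu)$ is, and in that case they are equal. -/

import Mathlib

open MeasureTheory Filter Topology
open scoped ENNReal Pointwise

noncomputable section

namespace SoficEntropy

/-- The set `V(F)` of points of `{1, …, m}` at which `σ` looks multiplicative and free on `F`. -/
def goodSet {G : Type*} [Group G] {m : ℕ} (σ : G → Equiv.Perm (Fin m)) (F : Set G) :
    Set (Fin m) :=
  {v | ∀ f₁ ∈ F, ∀ f₂ ∈ F,
    σ f₁ (σ f₂ v) = σ (f₁ * f₂) v ∧ (f₁ ≠ f₂ → σ f₁ v ≠ σ f₂ v)}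

/-- `σ` is an `(F, ε)`-approximation to `G`. -/
def IsApproximation {G : Type*} [Group G] {m : ℕ} (σ : G → Equiv.Perm (Fin m))
    (F : Set G) (ε : ℝ) : Prop :=
  (1 - ε) * (m : ℝ) ≤ ((goodSet σ F).ncard : ℝ)

/-- A map sequence for `G`: maps (not assumed to be homomorphisms) `σ i : G → Sym (m i)` with
`m i ≥ 1` and `m i → ∞`. -/
structure MapSequence (G : Type*) where
  m : ℕ → ℕ
  m_pos : ∀ i, 0 < m i
  tendsto_m : Tendsto m atTop atTop
  σ : ∀ i, G → Equiv.Perm (Fin (m i))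

/-- A sofic approximation to `G`. -/
def MapSequence.IsSoficApproximation {G : Type*} [Group G] (S : MapSequence G) : Prop :=
  ∃ (F : ℕ → Set G) (ε : ℕ → ℝ),
    (∀ i, F i ⊆ F (i + 1)) ∧ (⋃ i, F i) = Set.univ ∧ Tendsto ε atTop (𝓝 0) ∧
      ∀ i, IsApproximation (S.σ i) (F i) (ε i)

/-- An ordered measurable partition of `X` with atoms indexed by `ι`, encoded by the function
sending a point to the index of its atom. Atoms may be empty. Finite partitions with `u` atoms
are indexed by `Fin u`, at most countable ones by `ℕ`. -/
structure OrdPartition (X : Type*) [MeasurableSpace X] (ι : Type*) where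
  label : X → ι
  measurableSet_fiber : ∀ i, MeasurableSet (label ⁻¹' {i})

/-- The atom with index `i`. -/
def OrdPartition.atom {X : Type*} [MeasurableSpace X] {ι : Type*} (α : OrdPartition X ι)
    (i : ι) : Set X :=
  α.label ⁻¹' {i}

/-- A finite ordered partition regarded as a countable one, all further atoms being empty. -/
def OrdPartition.toNat {X : Type*} [MeasurableSpace X] {u : ℕ} (α : OrdPartition X (Fin u)) :
    OrdPartition X ℕ where
  label x := (α.label x : ℕ)
  measurableSet_fiber i := by
    by_cases h : i < u
    · have : (fun x => (α.label x : ℕ)) ⁻¹' {i} = α.label ⁻¹' {⟨i, h⟩} := by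
        ext x; simp [Fin.ext_iff]
      rw [this]; exact α.measurableSet_fiber _
    · have : (fun x => (α.label x : ℕ)) ⁻¹' {i} = ∅ := by
        ext x
        simp only [Set.mem_preimage, Set.mem_singleton_iff, Set.mem_empty_iff_false, iff_false]
        have := (α.label x).isLt
        omega
      rw [this]; exact MeasurableSet.empty

/-- The Shannon entropy `H(α) = -∑ μ(A_i) log μ(A_i)`, with value in `[0, ∞]`. -/
def shannonEntropy {X : Type*} [MeasurableSpace X] (μ : Measure X) (α : OrdPartition X ℕ) :
    ℝ≥0∞ :=
  ∑' i, ENNReal.ofReal (Real.negMulLog (μ.real (α.atom i)))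

open Classical in
/-- `d_F(α, β) = ∑_φ |μ(A_φ) - ζ(B_φ)|` for a finite partition `α` of `X` and a partition of
`{1, …, m}` given by its label function `b`, where `A_φ = ⋂_{f ∈ F} f A_{φ(f)}`,
`B_φ = ⋂_{f ∈ F} σ(f) B_{φ(f)}` and `ζ` is the uniform probability measure. -/
def distF {G : Type*} [Group G] {X : Type*} [MeasurableSpace X] [MulAction G X] (μ : Measure X)
    {m u : ℕ} (σ : G → Equiv.Perm (Fin m)) (F : Finset G) (α : OrdPartition X (Fin u))
    (b : Fin m → Fin u) : ℝ :=
  ∑ φ : F → Fin u,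
    |μ.real (⋂ f : F, (f : G) • α.atom (φ f)) -
      ((⋂ f : F, σ (f : G) '' (b ⁻¹' {φ f})).ncard : ℝ) / (m : ℝ)|

/-- The set `AP(σ, α : F, ε)` of approximating ordered partitions of `{1, …, m}`. -/
def approxPartitions {G : Type*} [Group G] {X : Type*} [MeasurableSpace X] [MulAction G X]
    (μ : Measure X) {m u : ℕ} (σ : G → Equiv.Perm (Fin m)) (α : OrdPartition X (Fin u))
    (F : Finset G) (ε : ℝ) : Set (Fin m → Fin u) :=
  {b | distF μ σ F α b ≤ ε}

/-- `H(Σ, α : F, ε) = limsup_i (1 / m_i) log |AP(σ_i, α : F, ε)|` for finite `α`,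
with `log 0 = -∞`. -/
def entropyFinEps {G : Type*} [Group G] {X : Type*} [MeasurableSpace X] [MulAction G X]
    (S : MapSequence G) (μ : Measure X) {u : ℕ} (α : OrdPartition X (Fin u))
    (F : Finset G) (ε : ℝ) : EReal :=
  limsup (fun i => ENNReal.log ((approxPartitions μ (S.σ i) α F ε).ncard : ℝ≥0∞) /
    (S.m i : EReal)) atTop

/-- `H(Σ, α : F)` for finite `α`: the limit as `ε → 0`, i.e. the infimum over `ε > 0`, of the
monotone quantity `H(Σ, α : F, ε)`. -/
def entropyFin {G : Type*} [Group G] {X : Type*} [MeasurableSpace X] [MulAction G X]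
    (S : MapSequence G) (μ : Measure X) {u : ℕ} (α : OrdPartition X (Fin u))
    (F : Finset G) : EReal :=
  ⨅ ε : {ε : ℝ // 0 < ε}, entropyFinEps S μ α F ε

/-- The mean `Σ`-entropy of a finite partition, computed directly. -/
def meanEntropyFin {G : Type*} [Group G] {X : Type*} [MeasurableSpace X] [MulAction G X]
    (S : MapSequence G) (μ : Measure X) {u : ℕ} (α : OrdPartition X (Fin u)) : EReal :=
  ⨅ F : Finset G, entropyFin S μ α F

/-- The partition into the fibres of `a` refines the partition into the fibres of `b`: every atom
of the first is, up to a null set, contained in an atom of the second. -/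
def Refines {X : Type*} [MeasurableSpace X] (μ : Measure X) {ι κ : Type*}
    (a : X → ι) (b : X → κ) : Prop :=
  ∀ i, ∃ j, μ (a ⁻¹' {i} \ b ⁻¹' {j}) = 0

/-- `γ` is a chain of `α`: finite partitions `γ 0 ≤ γ 1 ≤ ⋯ ≤ α` whose join is `α` up to null
sets. The join of all `γ n` is the partition into the fibres of `x ↦ (n ↦ label of x in γ n)`;
that `α` refines it follows from `α` refining every `γ n`. -/
structure IsChain {X : Type*} [MeasurableSpace X] (μ : Measure X) (α : OrdPartition X ℕ)
    (u : ℕ → ℕ) (γ : ∀ n, OrdPartition X (Fin (u n))) : Prop where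
  mono : ∀ n, Refines μ (γ (n + 1)).label (γ n).label
  le : ∀ n, Refines μ α.label (γ n).label
  join : Refines μ (fun x n => (γ n).label x) α.label

/-- `H(Σ, α : F)` for an at most countable partition `α`: the infimum of
`lim_n H(Σ, γ_n : F)` over all chains `γ` of `α`. -/
def entropyF {G : Type*} [Group G] {X : Type*} [MeasurableSpace X] [MulAction G X]
    (S : MapSequence G) (μ : Measure X) (α : OrdPartition X ℕ) (F : Finset G) : EReal :=
  sInf {L : EReal | ∃ (u : ℕ → ℕ) (γ : ∀ n, OrdPartition X (Fin (u n))), IsChain μ α u γ ∧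
    Tendsto (fun n => entropyFin S μ (γ n) F) atTop (𝓝 L)}

/-- The mean `Σ`-entropy `h(Σ, α)`. -/
def meanEntropy {G : Type*} [Group G] {X : Type*} [MeasurableSpace X] [MulAction G X]
    (S : MapSequence G) (μ : Measure X) (α : OrdPartition X ℕ) : EReal :=
  ⨅ F : Finset G, entropyF S μ α F

/-- The smallest `G`-invariant σ-algebra containing all sets of the family `A`. -/
@[reducible]
def invariantSigma (G : Type*) [Group G] {X : Type*} [MulAction G X] {ι : Type*}
    (A : ι → Set X) : MeasurableSpace X :=
  sInf {𝓜 : MeasurableSpace X |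
    (∀ (g : G) (s : Set X), MeasurableSet[𝓜] s → MeasurableSet[𝓜] (g • s)) ∧
      ∀ i, MeasurableSet[𝓜] (A i)}

/-- `α` is generating. -/
def IsGenerating (G : Type*) [Group G] {X : Type*} [MeasurableSpace X] [MulAction G X]
    (μ : Measure X) (α : OrdPartition X ℕ) : Prop :=
  ∀ A : Set X, MeasurableSet A →
    ∃ A' : Set X, MeasurableSet[invariantSigma G α.atom] A' ∧ μ (symmDiff A A') = 0

open Classical in
/-- The entropy `h(Σ, G, X, μ)` of a system: the mean entropy of a generating partition of finite
Shannon entropy if there is one, and undefined (`none`) otherwise. -/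
def systemEntropy {G : Type*} [Group G] {X : Type*} [MeasurableSpace X] [MulAction G X]
    (S : MapSequence G) (μ : Measure X) : Option EReal :=
  if h : ∃ α : OrdPartition X ℕ, IsGenerating G μ α ∧ shannonEntropy μ α < ⊤ then
    some (meanEntropy S μ h.choose)
  else none

/-- The systems `(G, X, μ)` and `(G, Y, ν)` are measurably conjugate. -/
def MeasurablyConjugate (G : Type*) [Group G] {X Y : Type*} [MeasurableSpace X] [MulAction G X]
    [MeasurableSpace Y] [MulAction G Y] (μ : Measure X) (ν : Measure Y) : Prop :=
  ∃ (X' : Set X) (Y' : Set Y) (φ : X' ≃ᵐ Y'), μ X'ᶜ = 0 ∧ ν Y'ᶜ = 0 ∧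
    (∀ B : Set Y, MeasurableSet B →
      μ (Subtype.val '' {x : X' | (φ x : Y) ∈ B}) = ν B) ∧
    ∀ (g : G) (x : X'), ∃ hx : g • (x : X) ∈ X', (φ ⟨g • (x : X), hx⟩ : Y) = g • (φ x : Y)

end SoficEntropy

end

/-!
If a finite block code applied to the itineraries of `γ` predicts a partition `δ` up to a small
error, then the same code turns finite models of `γ` into finite models of `δ`, because the maps
`σ i` are multiplicative at most points. If in turn a block code of `δ` predicts a coarsening
`π ∘ γ` up to a small error, then a model of `γ` is known at most points, up to its label within a
fibre of `π`, once the resulting model of `δ` is known. Encoding the remaining labels with weights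
that satisfy Kraft's inequality shows that few models of `γ` lie over each model of `δ`, provided
that `γ` has small conditional entropy given `π ∘ γ`. For truncations of a partition of finite
entropy the latter holds as soon as `π` only merges a tail of small entropy, and codes exist in both
directions because the sets approximable by finitely many coordinates of the itineraries along a
chain form an invariant σ-algebra.
-/

namespace SoficEntropy

section Measure

variable {X Z κ : Type*} [MeasurableSpace X] [MeasurableSpace Z] {μ : Measure X} {ν : Measure Z}
  [IsFiniteMeasure μ] [IsFiniteMeasure ν]

theorem abs_measureReal_sub_le {s t e : Set X} (h : ∀ x ∉ e, x ∈ s ↔ x ∈ t) :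
    |μ.real s - μ.real t| ≤ μ.real e := by
  have le_add {s t : Set X} (h : ∀ x ∉ e, x ∈ s → x ∈ t) : μ.real s ≤ μ.real t + μ.real e := by
    refine (measureReal_mono fun x hx => ?_).trans (measureReal_union_le t e)
    by_cases hxe : x ∈ e
    · exact Or.inr hxe
    · exact Or.inl (h x hxe hx)
  rw [abs_sub_le_iff, sub_le_iff_le_add', sub_le_iff_le_add']
  exact ⟨le_add fun x hx => (h x hx).1, le_add fun x hx => (h x hx).2⟩

theorem sum_abs_le_two_mul [Fintype κ] {f : κ → ℝ} {η : ℝ}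
    (h : ∀ D : Finset κ, |∑ k ∈ D, f k| ≤ η) : ∑ k, |f k| ≤ 2 * η := by
  have hpos : ∑ k with 0 ≤ f k, |f k| ≤ η := by
    rw [Finset.sum_congr rfl fun k hk => abs_of_nonneg (Finset.mem_filter.1 hk).2]
    exact (le_abs_self _).trans (h _)
  have hneg : ∑ k with ¬ 0 ≤ f k, |f k| ≤ η := by
    rw [Finset.sum_congr rfl fun k hk => abs_of_neg (not_le.1 (Finset.mem_filter.1 hk).2),
      Finset.sum_neg_distrib]
    exact (neg_le_abs _).trans (h _)
  rw [← Finset.sum_filter_add_sum_filter_not Finset.univ (0 ≤ f ·), two_mul]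
  exact add_le_add hpos hneg

variable [MeasurableSpace κ] [MeasurableSingletonClass κ] {S : X → κ} {T : Z → κ}

theorem sum_measureReal_preimage_sub (hS : Measurable S) (hT : Measurable T) (D : Finset κ) :
    ∑ k ∈ D, (μ.real (S ⁻¹' {k}) - ν.real (T ⁻¹' {k})) =
      μ.real (S ⁻¹' D) - ν.real (T ⁻¹' D) := by
  rw [Finset.sum_sub_distrib,
    sum_measureReal_preimage_singleton _ fun k _ => hS (measurableSet_singleton k),
    sum_measureReal_preimage_singleton _ fun k _ => hT (measurableSet_singleton k)]

variable [Fintype κ]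

theorem abs_measureReal_preimage_sub_le_sum (hS : Measurable S) (hT : Measurable T) (D : Set κ) :
    |μ.real (S ⁻¹' D) - ν.real (T ⁻¹' D)| ≤
      ∑ k, |μ.real (S ⁻¹' {k}) - ν.real (T ⁻¹' {k})| := by
  classical
  rw [← D.coe_toFinset, ← sum_measureReal_preimage_sub hS hT]
  exact (Finset.abs_sum_le_sum_abs _ _).trans
    (Finset.sum_le_univ_sum_of_nonneg fun _ => abs_nonneg _)

theorem sum_abs_measureReal_preimage_sub_le (hS : Measurable S) (hT : Measurable T) {η : ℝ}
    (h : ∀ D : Set κ, |μ.real (S ⁻¹' D) - ν.real (T ⁻¹' D)| ≤ η) :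
    ∑ k, |μ.real (S ⁻¹' {k}) - ν.real (T ⁻¹' {k})| ≤ 2 * η := by
  refine sum_abs_le_two_mul fun D => ?_
  rw [sum_measureReal_preimage_sub hS hT]
  exact h D

end Measure

/-- The uniform probability measure `ζ` on `{1, …, m}`. It is `0` for `m = 0`. -/
noncomputable abbrev uniform (m : ℕ) : Measure (Fin m) := ProbabilityTheory.uniformOn Set.univ

theorem uniform_real {m : ℕ} (s : Set (Fin m)) : (uniform m).real s = s.ncard / m := by
  rw [measureReal_def, ProbabilityTheory.uniformOn_univ, Measure.count_apply .of_discrete,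
    ← s.toFinite.cast_ncard_eq, ENNReal.toReal_div, Fintype.card_fin,
    ENat.toENNReal_coe, ENNReal.toReal_natCast, ENNReal.toReal_natCast]

theorem mul_uniform_real {m : ℕ} (s : Set (Fin m)) : m * (uniform m).real s = s.ncard := by
  rcases m.eq_zero_or_pos with rfl | hm
  · simp [Set.eq_empty_of_isEmpty s]
  · rw [uniform_real]
    field_simp

theorem uniform_real_image_perm {m : ℕ} (e : Equiv.Perm (Fin m)) (s : Set (Fin m)) :
    (uniform m).real (e '' s) = (uniform m).real s := by
  rw [uniform_real, uniform_real, Set.ncard_image_of_injective s e.injective]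

section Itinerary

variable {G : Type*}

/-- The itinerary `g ↦ b(σ(g)⁻¹ v)` of a point of the finite model `{1, …, m}`. -/
def modelItinerary {m : ℕ} (σ : G → Equiv.Perm (Fin m)) {ι : Type*} (b : Fin m → ι) (v : Fin m) :
    G → ι :=
  fun g => b ((σ g)⁻¹ v)

theorem iInter_image_preimage_eq {m : ℕ} (σ : G → Equiv.Perm (Fin m)) {ι : Type*} (b : Fin m → ι)
    (F : Finset G) (φ : F → ι) :
    ⋂ f : F, σ f '' (b ⁻¹' {φ f}) = (F.restrict ∘ modelItinerary σ b) ⁻¹' {φ} := by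
  ext v
  simp only [Equiv.image_eq_preimage_symm, Set.mem_iInter, Set.mem_preimage, Set.mem_singleton_iff,
    funext_iff]
  rfl

theorem exists_eq_preimage_restrict {ι : Type*} {E : Set (G → ι)} {F : Finset G}
    (hE : DependsOn (· ∈ E) (F : Set G)) : ∃ D : Set (F → ι), E = F.restrict ⁻¹' D := by
  obtain ⟨D, hD⟩ := dependsOn_iff_exists_comp.1 hE
  exact ⟨D, hD⟩

variable [Group G] {X : Type*} [MeasurableSpace X] [MulAction G X] {ι : Type*}

variable (G) in
/-- The itinerary `g ↦ α(g⁻¹ x)` of a point with respect to a partition. -/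
def itinerary (α : OrdPartition X ι) (x : X) : G → ι :=
  fun g => α.label (g⁻¹ • x)

theorem itinerary_inv_smul (α : OrdPartition X ι) (g : G) (x : X) :
    itinerary G α (g⁻¹ • x) = fun h => itinerary G α x (g * h) := by
  funext h
  simp only [itinerary, mul_inv_rev, mul_smul]

theorem iInter_smul_atom_eq (α : OrdPartition X ι) (F : Finset G) (φ : F → ι) :
    ⋂ f : F, (f : G) • α.atom (φ f) = (F.restrict ∘ itinerary G α) ⁻¹' {φ} := by
  ext x
  simp [Set.mem_smul_set_iff_inv_smul_mem, OrdPartition.atom, itinerary, funext_iff]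

theorem OrdPartition.measurable_label [Countable ι] [MeasurableSpace ι] (α : OrdPartition X ι) :
    Measurable α.label :=
  measurable_to_countable' α.measurableSet_fiber

variable [MeasurableConstSMul G X]

theorem measurable_itinerary [Countable ι] [MeasurableSpace ι] (α : OrdPartition X ι) :
    Measurable (itinerary G α) :=
  measurable_pi_lambda _ fun g => α.measurable_label.comp (measurable_const_smul g⁻¹)

variable {μ : Measure X} [IsFiniteMeasure μ] {m u : ℕ} {σ : G → Equiv.Perm (Fin m)}
  {F : Finset G} {α : OrdPartition X (Fin u)} {b : Fin m → Fin u}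

theorem abs_measureReal_sub_uniform_le_distF {E : Set (G → Fin u)}
    (hE : DependsOn (· ∈ E) (F : Set G)) :
    |μ.real (itinerary G α ⁻¹' E) - (uniform m).real (modelItinerary σ b ⁻¹' E)| ≤
      distF μ σ F α b := by
  classical
  obtain ⟨D, rfl⟩ := exists_eq_preimage_restrict hE
  simp only [distF, iInter_smul_atom_eq, iInter_image_preimage_eq, ← uniform_real]
  exact abs_measureReal_preimage_sub_le_sum
    ((Finset.measurable_restrict F).comp (measurable_itinerary α)) .of_discrete D

theorem distF_le_two_mul {η : ℝ} (h : ∀ E : Set (G → Fin u), DependsOn (· ∈ E) (F : Set G) →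
      |μ.real (itinerary G α ⁻¹' E) - (uniform m).real (modelItinerary σ b ⁻¹' E)| ≤ η) :
    distF μ σ F α b ≤ 2 * η := by
  classical
  simp only [distF, iInter_smul_atom_eq, iInter_image_preimage_eq, ← uniform_real]
  exact sum_abs_measureReal_preimage_sub_le
    ((Finset.measurable_restrict F).comp (measurable_itinerary α)) .of_discrete
    fun D => h (F.restrict ⁻¹' D) (dependsOn_iff_exists_comp.2 ⟨D, rfl⟩)

end Itinerary

section Sofic

variable {G : Type*} [Group G]

/-- The set of points at which `v ↦ σ(g)⁻¹ v` fails to behave like an action of the elements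
of `T`. The maps are inverted because itineraries read off the labels of `g⁻¹ x`. -/
def mulDefect {m : ℕ} (σ : G → Equiv.Perm (Fin m)) (T : Finset G) : Set (Fin m) :=
  {v | ∃ g ∈ T, ∃ h ∈ T, (σ (g * h))⁻¹ v ≠ (σ h)⁻¹ ((σ g)⁻¹ v)}

theorem mulDefect_eq_biUnion {m : ℕ} (σ : G → Equiv.Perm (Fin m)) (T : Finset G) :
    mulDefect σ T =
      ⋃ g ∈ T, ⋃ h ∈ T, (σ g * σ h) '' {v | σ g (σ h v) ≠ σ (g * h) v} := by
  ext v
  simp only [mulDefect, Set.mem_iUnion, exists_prop, Equiv.image_eq_preimage_symm]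
  refine exists_congr fun g => and_congr_right fun _ => exists_congr fun h =>
    and_congr_right fun _ => not_congr ?_
  change _ ↔ (σ g * σ h) ((σ g * σ h)⁻¹ v) = σ (g * h) ((σ g * σ h)⁻¹ v)
  rw [← Equiv.Perm.mul_apply (σ g * σ h), mul_inv_cancel, Equiv.Perm.one_apply, mul_inv_rev,
    Equiv.Perm.inv_eq_iff_eq, Equiv.Perm.mul_apply]

/-- The maps `σ_i` are asymptotically homomorphisms: `σ_i(g) σ_i(h)` and `σ_i(g h)` agree off a
set of vanishing density. -/
def MapSequence.IsAsymptoticHom (S : MapSequence G) : Prop :=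
  ∀ g h : G, Tendsto
    (fun i => (uniform (S.m i)).real {v | S.σ i g (S.σ i h v) ≠ S.σ i (g * h) v}) atTop (𝓝 0)

theorem MapSequence.IsAsymptoticHom.tendsto_mulDefect {S : MapSequence G}
    (hS : S.IsAsymptoticHom) (T : Finset G) :
    Tendsto (fun i => (uniform (S.m i)).real (mulDefect (S.σ i) T)) atTop (𝓝 0) := by
  have hsum : Tendsto (fun i => ∑ g ∈ T, ∑ h ∈ T,
      (uniform (S.m i)).real {v | S.σ i g (S.σ i h v) ≠ S.σ i (g * h) v}) atTop (𝓝 0) := by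
    simpa using tendsto_finsetSum T fun g _ => tendsto_finsetSum T fun h _ => hS g h
  refine squeeze_zero (fun _ => measureReal_nonneg) (fun i => ?_) hsum
  rw [mulDefect_eq_biUnion]
  refine (measureReal_biUnion_finset_le _ _).trans (Finset.sum_le_sum fun g _ => ?_)
  refine (measureReal_biUnion_finset_le _ _).trans_eq (Finset.sum_congr rfl fun h _ => ?_)
  exact uniform_real_image_perm _ _

theorem IsApproximation.uniform_real_compl_goodSet_le {m : ℕ} (hm : 0 < m)
    {σ : G → Equiv.Perm (Fin m)} {F : Set G} {ε : ℝ} (h : IsApproximation σ F ε) :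
    (uniform m).real (goodSet σ F)ᶜ ≤ ε := by
  have : NeZero m := ⟨hm.ne'⟩
  rw [probReal_compl_eq_one_sub .of_discrete, sub_le_comm, uniform_real,
    le_div_iff₀ (by exact_mod_cast hm)]
  exact h

theorem MapSequence.IsSoficApproximation.isAsymptoticHom {S : MapSequence G}
    (hS : S.IsSoficApproximation) : S.IsAsymptoticHom := by
  obtain ⟨F, ε, hmono, hF, hε, happrox⟩ := hS
  have eventually_mem (g : G) : ∀ᶠ i in atTop, g ∈ F i := by
    obtain ⟨n, hn⟩ := Set.mem_iUnion.1 (hF ▸ Set.mem_univ g)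
    filter_upwards [eventually_ge_atTop n] with i hi using monotone_nat_of_le_succ hmono hi hn
  refine fun g h => squeeze_zero' (.of_forall fun _ => measureReal_nonneg) ?_ hε
  filter_upwards [eventually_mem g, eventually_mem h] with i hg hh
  have hsub : {v | S.σ i g (S.σ i h v) ≠ S.σ i (g * h) v} ⊆ (goodSet (S.σ i) (F i))ᶜ :=
    fun v hv hgood => hv (hgood g hg h hh).1
  exact (measureReal_mono hsub).trans ((happrox i).uniform_real_compl_goodSet_le (S.m_pos i))

end Sofic

section Code

variable {G : Type*} [Group G] {ι κ ρ : Type*}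

/-- The equivariant extension `w ↦ (g ↦ c(w(g ·)))` of a block code `c`. -/
def codeMap (c : (G → ι) → κ) (w : G → ι) : G → κ :=
  fun g => c fun h => w (g * h)

/-- The model of `c(itinerary)` obtained by applying a block code `c` to the model itineraries
of `b`. -/
def codeModel {m : ℕ} (σ : G → Equiv.Perm (Fin m)) (c : (G → ι) → κ) (b : Fin m → ι) : Fin m → κ :=
  fun v => c (modelItinerary σ b v)

theorem dependsOn_comp_codeMap [DecidableEq G] {c : (G → ι) → κ} {F F' : Finset G}
    (hc : DependsOn c (F' : Set G)) {d : (G → κ) → ρ} (hd : DependsOn d (F : Set G)) :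
    DependsOn (d ∘ codeMap c) ((F * F' : Finset G) : Set G) :=
  fun _ _ h => hd fun _ hg => hc fun _ hk => h _ (Finset.mul_mem_mul hg hk)

theorem modelItinerary_codeModel {m : ℕ} {σ : G → Equiv.Perm (Fin m)} {T : Finset G}
    {c : (G → ι) → κ} (hc : DependsOn c (T : Set G)) (b : Fin m → ι) {v : Fin m}
    (hv : v ∉ mulDefect σ T) {g : G} (hg : g ∈ T) :
    modelItinerary σ (codeModel σ c b) v g = codeMap c (modelItinerary σ b v) g := by
  refine hc fun h hh => congrArg b ?_
  by_contra hne
  exact hv ⟨g, hg, h, hh, Ne.symm hne⟩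

theorem modelItinerary_one {m : ℕ} {σ : G → Equiv.Perm (Fin m)} {T : Finset G} (h1 : 1 ∈ T)
    (b : Fin m → ι) {v : Fin m} (hv : v ∉ mulDefect σ T) : modelItinerary σ b v 1 = b v := by
  have h : (σ (1 * 1))⁻¹ v = (σ 1)⁻¹ ((σ 1)⁻¹ v) := by
    by_contra hne
    exact hv ⟨1, h1, 1, h1, hne⟩
  rw [mul_one] at h
  exact congrArg b ((σ 1)⁻¹.injective h).symm

variable {X : Type*} [MeasurableSpace X] [MulAction G X]

theorem codeMap_itinerary (α : OrdPartition X ι) (c : (G → ι) → κ) (x : X) (g : G) :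
    codeMap c (itinerary G α x) g = c (itinerary G α (g⁻¹ • x)) := by
  rw [itinerary_inv_smul, codeMap]

/-- The block code `c` with window `F`, applied to itineraries with respect to `γ`, predicts `a`
up to an error of measure `θ`. -/
structure IsApproxCode (μ : Measure X) (γ : OrdPartition X ι) (c : (G → ι) → κ) (F : Finset G)
    (a : X → κ) (θ : ℝ) : Prop where
  dependsOn : DependsOn c (F : Set G)
  error_le : μ.real {x | a x ≠ c (itinerary G γ x)} ≤ θ

theorem IsApproxCode.mono {μ : Measure X} {γ : OrdPartition X ι} {c : (G → ι) → κ}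
    {F F' : Finset G} {a : X → κ} {θ : ℝ} (h : IsApproxCode μ γ c F a θ) (hF : F ⊆ F') :
    IsApproxCode μ γ c F' a θ :=
  ⟨h.dependsOn.mono (by exact_mod_cast hF), h.error_le⟩

variable {μ : Measure X} [SMulInvariantMeasure G X μ]

theorem IsApproxCode.measureReal_itinerary_ne_le {γ : OrdPartition X ι} {δ : OrdPartition X κ}
    {c : (G → ι) → κ} {T : Finset G} {θ : ℝ} (hc : IsApproxCode μ γ c T δ.label θ)
    (F : Finset G) :
    μ.real {x | ∃ g ∈ F, itinerary G δ x g ≠ codeMap c (itinerary G γ x) g} ≤ F.card * θ := by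
  have : {x | ∃ g ∈ F, itinerary G δ x g ≠ codeMap c (itinerary G γ x) g} =
      ⋃ g ∈ F, (g⁻¹ • ·) ⁻¹' {x | δ.label x ≠ c (itinerary G γ x)} := by
    ext x
    simp only [codeMap_itinerary, Set.mem_iUnion, exists_prop]
    rfl
  rw [this, ← nsmul_eq_mul]
  refine (measureReal_biUnion_finset_le _ _).trans (Finset.sum_le_card_nsmul _ _ _ fun g _ => ?_)
  rw [measureReal_def, measure_preimage_smul]
  exact hc.error_le

variable [IsFiniteMeasure μ] [MeasurableConstSMul G X] [DecidableEq G] {m u k : ℕ}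
  {σ : G → Equiv.Perm (Fin m)} {F T : Finset G}
  {γ : OrdPartition X (Fin u)} {δ : OrdPartition X (Fin k)} {c : (G → Fin u) → Fin k} {θ θ' : ℝ}

theorem IsApproxCode.distF_codeModel_le (hc : IsApproxCode μ γ c T δ.label θ) (hF : F ⊆ T)
    (b : Fin m → Fin u) :
    distF μ σ F δ (codeModel σ c b) ≤
      2 * (F.card * θ + (distF μ σ (T * T) γ b + (uniform m).real (mulDefect σ T))) := by
  refine distF_le_two_mul fun E hE => ?_
  have hE' : DependsOn (· ∈ codeMap c ⁻¹' E) ((T * T : Finset G) : Set G) :=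
    (dependsOn_comp_codeMap hc.dependsOn hE).mono (by
      exact_mod_cast Finset.mul_subset_mul_right hF)
  have hcode : |μ.real (itinerary G δ ⁻¹' E) - μ.real (itinerary G γ ⁻¹' (codeMap c ⁻¹' E))| ≤
      F.card * θ := by
    refine (abs_measureReal_sub_le fun x hx => ?_).trans (hc.measureReal_itinerary_ne_le F)
    exact iff_of_eq (hE fun g hg => by_contra fun hne => hx ⟨g, hg, hne⟩)
  have hmodel : |(uniform m).real (modelItinerary σ b ⁻¹' (codeMap c ⁻¹' E)) -
      (uniform m).real (modelItinerary σ (codeModel σ c b) ⁻¹' E)| ≤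
      (uniform m).real (mulDefect σ T) := by
    refine abs_measureReal_sub_le fun v hv => iff_of_eq (Eq.symm ?_)
    exact hE fun g hg => modelItinerary_codeModel hc.dependsOn b hv (hF hg)
  exact (abs_sub_le _ _ _).trans (add_le_add hcode ((abs_sub_le _ _ _).trans
    (add_le_add (abs_measureReal_sub_uniform_le_distF hE') hmodel)))

theorem IsApproxCode.uniform_decode_ne_le (hc : IsApproxCode μ γ c T δ.label θ)
    {π : Fin u → ρ} {d : (G → Fin k) → ρ} (hd : IsApproxCode μ δ d F (π ∘ γ.label) θ')
    (hF : F ⊆ T) (h1 : 1 ∈ T) (b : Fin m → Fin u) :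
    (uniform m).real {v | π (b v) ≠ d (modelItinerary σ (codeModel σ c b) v)} ≤
      θ' + F.card * θ + (distF μ σ (T * T) γ b + (uniform m).real (mulDefect σ T)) := by
  set E : Set (G → Fin u) := {w | π (w 1) ≠ d (codeMap c w)}
  have hE : DependsOn (· ∈ E) ((T * T : Finset G) : Set G) := by
    intro w w' h
    have hw1 : w 1 = w' 1 := h 1 (by exact_mod_cast Finset.mem_mul.2 ⟨1, h1, 1, h1, one_mul 1⟩)
    have hdw : d (codeMap c w) = d (codeMap c w') :=
      dependsOn_comp_codeMap hc.dependsOn hd.dependsOn fun g hg =>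
        h g (by exact_mod_cast Finset.mul_subset_mul_right hF hg)
    simp only [E, Set.mem_ofPred_eq, hw1, hdw]
  have hmeas : μ.real (itinerary G γ ⁻¹' E) ≤ θ' + F.card * θ := by
    refine (measureReal_mono fun x hx => ?_).trans ((measureReal_union_le _ _).trans
      (add_le_add hd.error_le (hc.measureReal_itinerary_ne_le F)))
    refine or_iff_not_imp_right.2 fun hx' heq => hx ?_
    have hdx : d (itinerary G δ x) = d (codeMap c (itinerary G γ x)) :=
      hd.dependsOn fun g hg => by_contra fun hne => hx' ⟨g, hg, hne⟩
    simpa [← hdx, itinerary] using heq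
  have hmodel : |(uniform m).real (modelItinerary σ b ⁻¹' E) -
      (uniform m).real {v | π (b v) ≠ d (modelItinerary σ (codeModel σ c b) v)}| ≤
      (uniform m).real (mulDefect σ T) := by
    refine abs_measureReal_sub_le fun v hv => ?_
    have hdv : d (modelItinerary σ (codeModel σ c b) v) = d (codeMap c (modelItinerary σ b v)) :=
      hd.dependsOn fun g hg => modelItinerary_codeModel hc.dependsOn b hv (hF hg)
    simp only [E, Set.mem_preimage, Set.mem_ofPred_eq, hdv, modelItinerary_one h1 b hv]
  have hlaw := abs_measureReal_sub_uniform_le_distF (μ := μ) (σ := σ) (α := γ) (b := b) hE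
  linarith [(abs_le.1 hmodel).1, (abs_le.1 hlaw).1]

end Code

section Average

variable {G X : Type*} [Group G] [MeasurableSpace X] [MulAction G X] [MeasurableConstSMul G X]
  {μ : Measure X} [IsFiniteMeasure μ] {m u : ℕ} {σ : G → Equiv.Perm (Fin m)} {F : Finset G}
  {γ : OrdPartition X (Fin u)}

theorem abs_measureReal_atom_sub_le_distF (h1 : 1 ∈ F) (b : Fin m → Fin u) (i : Fin u) :
    |μ.real (γ.atom i) - (uniform m).real (b ⁻¹' {i})| ≤ distF μ σ F γ b := by
  have hE : DependsOn (· ∈ {w : G → Fin u | w 1 = i}) (F : Set G) := by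
    intro w w' h
    simp only [Set.mem_ofPred_eq, h 1 h1]
  have hX : itinerary G γ ⁻¹' {w | w 1 = i} = γ.atom i := by
    ext x
    simp [itinerary, OrdPartition.atom]
  have hV : modelItinerary σ b ⁻¹' {w | w 1 = i} = σ 1 '' (b ⁻¹' {i}) := by
    rw [Equiv.image_eq_preimage_symm]
    rfl
  simpa only [hX, hV, uniform_real_image_perm] using
    abs_measureReal_sub_uniform_le_distF (μ := μ) (σ := σ) (α := γ) (b := b) hE

theorem sum_label_eq (b : Fin m → Fin u) (ψ : Fin u → ℝ) :
    ∑ v, ψ (b v) = m * ∑ i, (uniform m).real (b ⁻¹' {i}) * ψ i := by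
  classical
  rw [← Finset.sum_fiberwise' Finset.univ b ψ, Finset.mul_sum]
  refine Finset.sum_congr rfl fun i _ => ?_
  rw [← mul_assoc, mul_uniform_real, Finset.sum_const, nsmul_eq_mul, Set.ncard_eq_toFinset_card']
  congr 3
  ext v
  simp

theorem sum_label_le (h1 : 1 ∈ F) (b : Fin m → Fin u) (ψ : Fin u → ℝ) :
    ∑ v, ψ (b v) ≤
      m * (∑ i, μ.real (γ.atom i) * ψ i + (∑ i, |ψ i|) * distF μ σ F γ b) := by
  rw [sum_label_eq, Finset.sum_mul, ← Finset.sum_add_distrib]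
  refine mul_le_mul_of_nonneg_left (Finset.sum_le_sum fun i _ => ?_) m.cast_nonneg
  have h : ((uniform m).real (b ⁻¹' {i}) - μ.real (γ.atom i)) * ψ i ≤
      |ψ i| * distF μ σ F γ b := by
    refine (le_abs_self _).trans ?_
    rw [abs_mul, abs_sub_comm, mul_comm]
    exact mul_le_mul_of_nonneg_left (abs_measureReal_atom_sub_le_distF h1 b i) (abs_nonneg _)
  linarith

end Average

section Counting

variable {V ι ρ : Type*} [Fintype V] [DecidableEq ρ] {π : ι → ρ} {w : ι → ℝ} {κ t : ℝ}

theorem sum_neg_log_ite_weight (hw : ∀ i, 0 < w i) (ht : 0 < t) (a : V → ρ) (b : V → ι) :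
    ∑ v, -Real.log (if π (b v) = a v then w (b v) else t * w (b v)) =
      ∑ v, -Real.log (w (b v)) + {v | π (b v) ≠ a v}.ncard * -Real.log t := by
  have hcard : ({v | π (b v) ≠ a v}.ncard : ℝ) * -Real.log t =
      ∑ v, if π (b v) ≠ a v then -Real.log t else 0 := by
    rw [← Finset.sum_filter, Finset.sum_const, nsmul_eq_mul, Set.ncard_eq_toFinset_card',
      Set.toFinset_ofPred]
  rw [hcard, ← Finset.sum_add_distrib]
  refine Finset.sum_congr rfl fun v _ => ?_
  by_cases hv : π (b v) = a v
  · simp [hv]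
  · rw [if_neg hv, if_pos hv, Real.log_mul ht.ne' (hw _).ne', neg_add_rev]

variable [Fintype ι]

theorem ncard_le_of_weights {W : V → ι → ℝ} (hW : ∀ v i, 0 < W v i) {s K : ℝ}
    (hs : ∀ v, ∑ i, W v i ≤ Real.exp s) {B : Set (V → ι)}
    (hB : ∀ b ∈ B, ∑ v, -Real.log (W v (b v)) ≤ K) :
    (B.ncard : ℝ) ≤ Real.exp (Fintype.card V * s + K) := by
  classical
  have hprod (b : V → ι) (hb : b ∈ B) : Real.exp (-K) ≤ ∏ v, W v (b v) := by
    have hlog : -K ≤ ∑ v, Real.log (W v (b v)) :=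
      neg_le.1 (Finset.sum_neg_distrib (fun v => Real.log (W v (b v))) ▸ hB b hb)
    simpa only [Real.exp_sum, Real.exp_log (hW _ _)] using Real.exp_le_exp.2 hlog
  have hcount : B.ncard * Real.exp (-K) ≤ Real.exp (Fintype.card V * s) :=
    calc B.ncard * Real.exp (-K) = B.toFinset.card • Real.exp (-K) := by
          rw [Set.ncard_eq_toFinset_card', nsmul_eq_mul]
      _ ≤ ∑ b ∈ B.toFinset, ∏ v, W v (b v) :=
          Finset.card_nsmul_le_sum _ _ _ fun b hb => hprod b (Set.mem_toFinset.1 hb)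
      _ ≤ ∑ b : V → ι, ∏ v, W v (b v) :=
          Finset.sum_le_univ_sum_of_nonneg fun b => Finset.prod_nonneg fun v _ => (hW v _).le
      _ = ∏ v, ∑ i, W v i := (Fintype.prod_sum W).symm
      _ ≤ ∏ _v : V, Real.exp s :=
          Finset.prod_le_prod (fun v _ => Finset.sum_nonneg fun i _ => (hW v i).le) fun v _ => hs v
      _ = Real.exp (Fintype.card V * s) := by simp [Real.exp_nat_mul]
  rwa [Real.exp_neg, ← div_eq_mul_inv, div_le_iff₀ (Real.exp_pos K), ← Real.exp_add] at hcount

variable [Fintype ρ]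

theorem sum_ite_weight_le (hw : ∀ i, 0 < w i) (hκ : ∀ j, ∑ i with π i = j, w i ≤ Real.exp κ)
    (ht : 0 < t) (j : ρ) :
    ∑ i, (if π i = j then w i else t * w i) ≤ Real.exp (κ + t * Fintype.card ρ) := by
  have hall : ∑ i, w i ≤ Fintype.card ρ * Real.exp κ := by
    rw [← Finset.sum_fiberwise Finset.univ π, ← nsmul_eq_mul]
    exact Finset.sum_le_card_nsmul Finset.univ _ _ fun j _ => hκ j
  calc ∑ i, (if π i = j then w i else t * w i)
      ≤ ∑ i, ((if π i = j then w i else 0) + t * w i) := by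
        refine Finset.sum_le_sum fun i _ => ?_
        have := mul_pos ht (hw i)
        split_ifs <;> linarith
    _ = (∑ i with π i = j, w i) + t * ∑ i, w i := by
        rw [Finset.sum_add_distrib, Finset.sum_filter, Finset.mul_sum]
    _ ≤ Real.exp κ + t * (Fintype.card ρ * Real.exp κ) := by
        gcongr
        exact hκ j
    _ = Real.exp κ * (t * Fintype.card ρ + 1) := by ring
    _ ≤ Real.exp κ * Real.exp (t * Fintype.card ρ) := by
        gcongr
        exact Real.add_one_le_exp _
    _ = Real.exp (κ + t * Fintype.card ρ) := (Real.exp_add _ _).symm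

/- A label in the fibre of `π` prescribed by `a` is encoded by its weight; a label in another fibre
costs an additional `-log t`. -/
theorem ncard_le_of_fiber_weights (hw : ∀ i, 0 < w i)
    (hκ : ∀ j, ∑ i with π i = j, w i ≤ Real.exp κ) (ht : 0 < t) (ht1 : t ≤ 1) (a : V → ρ)
    {B : Set (V → ι)} {K D : ℝ} (hK : ∀ b ∈ B, ∑ v, -Real.log (w (b v)) ≤ K)
    (hD : ∀ b ∈ B, ({v | π (b v) ≠ a v}.ncard : ℝ) ≤ D) :
    (B.ncard : ℝ) ≤
      Real.exp (Fintype.card V * (κ + t * Fintype.card ρ) + (K + D * -Real.log t)) := by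
  refine ncard_le_of_weights (W := fun v i => if π i = a v then w i else t * w i)
    (fun v i => ?_) (fun v => sum_ite_weight_le hw hκ ht (a v)) fun b hb => ?_
  · split_ifs
    exacts [hw i, mul_pos ht (hw i)]
  · rw [sum_neg_log_ite_weight hw ht]
    have hlog : 0 ≤ -Real.log t := neg_nonneg.2 (Real.log_nonpos ht.le ht1)
    exact add_le_add (hK b hb) (mul_le_mul_of_nonneg_right (hD b hb) hlog)

theorem ncard_le_mul_of_mapsTo {A B : Type*} [Finite A] [Finite B] {s : Set A} {t : Set B}
    {f : A → B} (hf : Set.MapsTo f s t) {M : ℝ} (h : ∀ y ∈ t, ((s ∩ f ⁻¹' {y}).ncard : ℝ) ≤ M) :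
    (s.ncard : ℝ) ≤ t.ncard * M := by
  classical
  have := Fintype.ofFinite A
  have := Fintype.ofFinite B
  rw [Set.ncard_eq_toFinset_card', Set.ncard_eq_toFinset_card' t,
    Finset.card_eq_sum_card_fiberwise (f := f) (s := s.toFinset) (t := t.toFinset)
      (by simpa using hf), Nat.cast_sum, ← nsmul_eq_mul]
  refine Finset.sum_le_card_nsmul _ _ _ fun y hy => ?_
  have hfiber : {a ∈ s.toFinset | f a = y} = (s ∩ f ⁻¹' {y}).toFinset := by
    ext a
    simp
  rw [hfiber, ← Set.ncard_eq_toFinset_card']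
  exact h y (Set.mem_toFinset.1 hy)

theorem limsup_log_div_le {α : Type*} {l : Filter α} [l.NeBot] {m a b : α → ℕ} {B : ℝ}
    (hm : ∀ i, 0 < m i) (h : ∀ᶠ i in l, (a i : ℝ) ≤ b i * Real.exp (m i * B)) :
    limsup (fun i => ENNReal.log (a i : ℝ≥0∞) / (m i : EReal)) l ≤
      limsup (fun i => ENNReal.log (b i : ℝ≥0∞) / (m i : EReal)) l + (B : EReal) := by
  have hle : ∀ᶠ i in l, ENNReal.log (a i : ℝ≥0∞) / (m i : EReal) ≤
      ENNReal.log (b i : ℝ≥0∞) / (m i : EReal) + (B : EReal) := by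
    filter_upwards [h] with i hi
    have hlog : ENNReal.log (a i : ℝ≥0∞) ≤
        ENNReal.log (b i : ℝ≥0∞) + ((m i * B : ℝ) : EReal) := by
      have hi' := ENNReal.log_monotone (ENNReal.ofReal_le_ofReal hi)
      rwa [ENNReal.ofReal_mul (Nat.cast_nonneg _), ENNReal.ofReal_natCast,
        ENNReal.ofReal_natCast, ENNReal.log_mul_add,
        ENNReal.log_ofReal_of_pos (Real.exp_pos _), Real.log_exp] at hi'
    have hm0 : (0 : EReal) ≤ (m i : EReal) := by exact_mod_cast Nat.zero_le _
    refine (EReal.div_le_div_right_of_nonneg hm0 hlog).trans_eq ?_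
    rw [EReal.add_div_of_nonneg_right hm0, ← EReal.coe_coe_eq_natCast, ← EReal.coe_div,
      mul_div_cancel_left₀ B (Nat.cast_ne_zero.2 (hm i).ne')]
  refine (limsup_le_limsup hle).trans ?_
  refine (EReal.limsup_add_le (v := fun _ => (B : EReal)) (by simp) (by simp)).trans ?_
  rw [limsup_const]

end Counting

section Entropy

variable {G : Type*} [Group G] {X : Type*} [MeasurableSpace X] {u k l : ℕ}

/-- `w` is a system of weights for encoding the label `i` of a point once `π i` is known: up to
the factor `exp κ` it satisfies the Kraft inequality in each fibre of `π`, and the expected code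
length, where `i` has code length `-log (w i)`, is at most `κ`. -/
structure IsFiberWeight (μ : Measure X) (γ : OrdPartition X (Fin u)) (π : Fin u → Fin l)
    (w : Fin u → ℝ) (κ : ℝ) : Prop where
  pos : ∀ i, 0 < w i
  kraft : ∀ j, ∑ i with π i = j, w i ≤ Real.exp κ
  cost : ∑ i, μ.real (γ.atom i) * -Real.log (w i) ≤ κ

variable [MulAction G X] [MeasurableConstSMul G X] {μ : Measure X} [IsFiniteMeasure μ]
  [SMulInvariantMeasure G X μ] [DecidableEq G] {γ : OrdPartition X (Fin u)}
  {δ : OrdPartition X (Fin k)} {π : Fin u → Fin l} {w : Fin u → ℝ} {c : (G → Fin u) → Fin k}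
  {d : (G → Fin k) → Fin l} {F F₂ T : Finset G} {κ θ θ' t : ℝ}

theorem IsFiberWeight.ncard_approxPartitions_le (hw : IsFiberWeight μ γ π w κ)
    (hc : IsApproxCode μ γ c T δ.label θ) (hd : IsApproxCode μ δ d F₂ (π ∘ γ.label) θ')
    (hF : F ⊆ T) (hF₂ : F₂ ⊆ T) (h1 : 1 ∈ T) (ht : 0 < t) (ht1 : t ≤ 1) {m : ℕ}
    {σ : G → Equiv.Perm (Fin m)} {η : ℝ} (hη : (uniform m).real (mulDefect σ T) ≤ η) :
    ((approxPartitions μ σ γ (T * T) η).ncard : ℝ) ≤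
      (approxPartitions μ σ δ F (2 * (F.card * θ + (η + η)))).ncard *
        Real.exp (m * (κ + t * l + (κ + (∑ i, |-Real.log (w i)|) * η) +
          (θ' + F₂.card * θ + (η + η)) * -Real.log t)) := by
  have h1' : 1 ∈ T * T := Finset.mem_mul.2 ⟨1, h1, 1, h1, one_mul 1⟩
  refine ncard_le_mul_of_mapsTo (f := codeModel σ c) (fun b hb => ?_) fun b' _ => ?_
  · exact (hc.distF_codeModel_le hF b).trans (by gcongr; exact hb)
  refine (ncard_le_of_fiber_weights hw.pos hw.kraft ht ht1 (fun v => d (modelItinerary σ b' v))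
    (K := m * (κ + (∑ i, |-Real.log (w i)|) * η)) (D := m * (θ' + F₂.card * θ + (η + η)))
    ?_ ?_).trans_eq ?_
  · rintro b ⟨hb, -⟩
    refine (sum_label_le (μ := μ) (σ := σ) (γ := γ) h1' b fun i => -Real.log (w i)).trans ?_
    gcongr
    exacts [hw.cost, hb]
  · rintro b ⟨hb, rfl⟩
    rw [← mul_uniform_real]
    gcongr
    refine (hc.uniform_decode_ne_le hd hF₂ h1 b).trans ?_
    gcongr
    exact hb
  · rw [Fintype.card_fin, Fintype.card_fin]
    congr 1
    ring

theorem IsFiberWeight.entropyFin_le (hw : IsFiberWeight μ γ π w κ)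
    (hc : IsApproxCode μ γ c T δ.label θ) (hd : IsApproxCode μ δ d F₂ (π ∘ γ.label) θ')
    (hF : F ⊆ T) (hF₂ : F₂ ⊆ T) (h1 : 1 ∈ T) (ht : 0 < t) (ht1 : t ≤ 1) {S : MapSequence G}
    (hS : S.IsAsymptoticHom) {ε B : ℝ} (hε : 2 * (F.card * θ) < ε)
    (hB : κ + t * l + κ + (θ' + F₂.card * θ) * -Real.log t < B) :
    entropyFin S μ γ (T * T) ≤ entropyFinEps S μ δ F ε + (B : EReal) := by
  have hε' : ∀ᶠ η in 𝓝[>] (0 : ℝ), 2 * (F.card * θ + (η + η)) ≤ ε :=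
    (((by fun_prop : Continuous fun η : ℝ => 2 * (F.card * θ + (η + η))).tendsto' 0 _
      (by simp)).mono_left nhdsWithin_le_nhds).eventually_le_const hε
  have hB' : ∀ᶠ η in 𝓝[>] (0 : ℝ), κ + t * l + (κ + (∑ i, |-Real.log (w i)|) * η) +
      (θ' + F₂.card * θ + (η + η)) * -Real.log t ≤ B :=
    (((by fun_prop : Continuous fun η : ℝ => κ + t * l + (κ + (∑ i, |-Real.log (w i)|) * η) +
      (θ' + F₂.card * θ + (η + η)) * -Real.log t).tendsto' 0 _
      (by simp only [mul_zero, add_zero, add_assoc])).mono_left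
        nhdsWithin_le_nhds).eventually_le_const hB
  obtain ⟨η, ⟨hεη, hBη⟩, hη⟩ := ((hε'.and hB').and self_mem_nhdsWithin).exists
  refine (iInf_le _ ⟨η, hη⟩).trans (limsup_log_div_le S.m_pos ?_)
  filter_upwards [(hS.tendsto_mulDefect T).eventually_le_const hη] with i hi
  refine (hw.ncard_approxPartitions_le hc hd hF hF₂ h1 ht ht1 hi).trans ?_
  have hsub : approxPartitions μ (S.σ i) δ F (2 * (F.card * θ + (η + η))) ⊆
      approxPartitions μ (S.σ i) δ F ε := fun b hb => hb.trans hεη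
  gcongr
  exact Set.toFinite _

end Entropy

section Refinement

variable {X : Type*} [MeasurableSpace X] {μ : Measure X} {ι κ : Type*} {a : X → ι} {b : X → κ}

theorem Refines.of_factorsThrough [Nonempty κ] (h : b.FactorsThrough a) : Refines μ a b := by
  intro i
  by_cases hi : ∃ x, a x = i
  · obtain ⟨x, rfl⟩ := hi
    have hsub : a ⁻¹' {a x} \ b ⁻¹' {b x} = ∅ := Set.sdiff_eq_empty.2 fun y hy => h hy
    exact ⟨b x, by rw [hsub, measure_empty]⟩
  · have hempty : a ⁻¹' {i} = ∅ := Set.eq_empty_of_forall_notMem fun x hx => hi ⟨x, hx⟩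
    exact ⟨Classical.arbitrary κ, by rw [hempty, Set.empty_sdiff, measure_empty]⟩

theorem Refines.exists_ae_eq_comp [Countable ι] (h : Refines μ a b) :
    ∃ ρ : ι → κ, b =ᵐ[μ] ρ ∘ a := by
  choose ρ hρ using h
  refine ⟨ρ, ae_iff.2 (measure_mono_null (fun x hx => ?_) (measure_iUnion_null hρ))⟩
  exact Set.mem_iUnion.2 ⟨a x, rfl, hx⟩

variable {α : OrdPartition X ℕ} {u : ℕ → ℕ} {γ : ∀ n, OrdPartition X (Fin (u n))}

theorem IsChain.exists_ae_eq_comp (hγ : IsChain μ α u γ) {n k : ℕ} (hnk : n ≤ k) :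
    ∃ ρ : Fin (u k) → Fin (u n), (γ n).label =ᵐ[μ] ρ ∘ (γ k).label := by
  induction k, hnk using Nat.le_induction with
  | base => exact ⟨id, .rfl⟩
  | succ k _ ih =>
    obtain ⟨ρ, hρ⟩ := ih
    obtain ⟨τ, hτ⟩ := (hγ.mono k).exists_ae_eq_comp
    exact ⟨ρ ∘ τ, hρ.trans (hτ.fun_comp ρ)⟩

theorem IsChain.exists_atom_ae_eq_iInter (hγ : IsChain μ α u γ) {i : ℕ}
    (hi : μ (α.atom i) ≠ 0) :
    ∃ j : ∀ n, Fin (u n), α.atom i =ᵐ[μ] ⋂ n, (γ n).atom (j n) := by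
  choose j hj using fun n => hγ.le n i
  obtain ⟨i', hi'⟩ := hγ.join j
  have hfiber : (fun x n => (γ n).label x) ⁻¹' {j} = ⋂ n, (γ n).atom (j n) := by
    ext x
    simp [funext_iff, OrdPartition.atom]
  rw [hfiber] at hi'
  have hsub : μ (α.atom i \ ⋂ n, (γ n).atom (j n)) = 0 := by
    rw [Set.sdiff_iInter]
    exact measure_iUnion_null hj
  have hii' : i = i' := by
    by_contra hne
    refine hi (measure_mono_null (fun x hx => ?_) (measure_union_null hsub hi'))
    by_cases hx' : x ∈ ⋂ n, (γ n).atom (j n)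
    · exact Or.inr ⟨hx', fun h => hne (Eq.trans (Eq.symm hx) h)⟩
    · exact Or.inl ⟨hx, hx'⟩
  exact ⟨j, (ae_le_set.2 hsub).antisymm (ae_le_set.2 (hii' ▸ hi'))⟩

end Refinement

theorem exists_dependsOn_of_events {G ι κ : Type*} [Nonempty κ] (E : κ → Set (G → ι)) {F : Set G}
    (hE : ∀ j, DependsOn (· ∈ E j) F) :
    ∃ c : (G → ι) → κ, DependsOn c F ∧ ∀ w j, (∀ i, w ∈ E i ↔ i = j) → c w = j := by
  refine ⟨fun w => Classical.epsilon fun j => w ∈ E j, fun w w' hw => ?_, fun w j hj => ?_⟩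
  · simp only [fun j => hE j hw]
  · exact (hj _).1 (Classical.epsilon_spec (p := fun j => w ∈ E j) ⟨j, (hj j).2 rfl⟩)

section InvariantSigma

variable {G : Type*} [Group G] {X : Type*} [MulAction G X] {ι : Type*} {A : ι → Set X}

theorem invariantSigma_le {m : MeasurableSpace X}
    (hm : ∀ (g : G) (s : Set X), MeasurableSet[m] s → MeasurableSet[m] (g • s))
    (hA : ∀ i, MeasurableSet[m] (A i)) : invariantSigma G A ≤ m :=
  sInf_le ⟨hm, hA⟩

theorem measurableSet_invariantSigma (i : ι) :
    MeasurableSet[invariantSigma G A] (A i) :=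
  MeasurableSpace.measurableSet_sInf.2 fun _ hm => hm.2 i

theorem measurableSet_invariantSigma_smul {s : Set X}
    (hs : MeasurableSet[invariantSigma G A] s) (g : G) :
    MeasurableSet[invariantSigma G A] (g • s) :=
  MeasurableSpace.measurableSet_sInf.2 fun m hm =>
    hm.1 g s (MeasurableSpace.measurableSet_sInf.1 hs m hm)

end InvariantSigma

section Approximable

variable {G : Type*} [Group G] {X : Type*} [MeasurableSpace X] [MulAction G X]
  {μ : Measure X} {u : ℕ → ℕ} {γ : ∀ n, OrdPartition X (Fin (u n))} {A B : Set X}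
  {α : OrdPartition X ℕ}

variable (G μ γ) in
/-- `A` can be approximated by events depending on finitely many coordinates of the itinerary
with respect to `γ n`, the window being the same for all large `n`. -/
def Approximable (A : Set X) : Prop :=
  ∀ θ : ℝ, 0 < θ → ∃ F : Finset G, ∀ᶠ n in atTop, ∃ E : Set (G → Fin (u n)),
    DependsOn (· ∈ E) (F : Set G) ∧ μ.real (symmDiff A (itinerary G (γ n) ⁻¹' E)) ≤ θ

theorem approximable_empty : Approximable G μ γ ∅ :=
  fun θ hθ => ⟨∅, .of_forall fun _ => ⟨∅, fun _ _ _ => rfl, by simp [hθ.le]⟩⟩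

theorem Approximable.compl (hA : Approximable G μ γ A) : Approximable G μ γ Aᶜ := by
  intro θ hθ
  obtain ⟨F, hF⟩ := hA θ hθ
  refine ⟨F, hF.mono fun n ⟨E, hE, hμ⟩ => ⟨Eᶜ, fun w w' hw => congrArg Not (hE hw), ?_⟩⟩
  rwa [Set.preimage_compl, compl_symmDiff_compl]

theorem Approximable.smul [SMulInvariantMeasure G X μ] (hA : Approximable G μ γ A) (g : G) :
    Approximable G μ γ (g • A) := by
  classical
  intro θ hθ
  obtain ⟨F, hF⟩ := hA θ hθ
  refine ⟨F.image (g * ·), hF.mono fun n ⟨E, hE, hμ⟩ => ?_⟩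
  refine ⟨{w | (fun h => w (g * h)) ∈ E},
    fun w w' hw => hE fun h hh => hw _ (Finset.mem_image_of_mem _ hh), ?_⟩
  have hpre : itinerary G (γ n) ⁻¹' {w | (fun h => w (g * h)) ∈ E} =
      g • itinerary G (γ n) ⁻¹' E := by
    ext x
    rw [Set.mem_smul_set_iff_inv_smul_mem, Set.mem_preimage, Set.mem_preimage,
      itinerary_inv_smul]
    rfl
  rwa [hpre, ← Set.smul_set_symmDiff, measureReal_def, measure_smul]

theorem approximable_of_eventually_ae_eq
    (h : ∀ᶠ n in atTop, ∃ D : Set (Fin (u n)), A =ᵐ[μ] (γ n).label ⁻¹' D) :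
    Approximable G μ γ A := by
  refine fun θ hθ => ⟨{1}, h.mono fun n ⟨D, hD⟩ => ⟨{w | w 1 ∈ D}, fun w w' hw => ?_, ?_⟩⟩
  · simp only [Set.mem_ofPred_eq, hw 1 (by simp)]
  · have hpre : itinerary G (γ n) ⁻¹' {w | w 1 ∈ D} = (γ n).label ⁻¹' D := by
      ext x
      simp [itinerary]
    rw [hpre, measureReal_def, measure_symmDiff_eq_zero_iff.2 hD]
    exact hθ.le

theorem IsChain.approximable_chain_atom (hγ : IsChain μ α u γ) (n : ℕ) (j : Fin (u n)) :
    Approximable G μ γ ((γ n).atom j) := by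
  refine approximable_of_eventually_ae_eq ((eventually_ge_atTop n).mono fun k hk => ?_)
  obtain ⟨ρ, hρ⟩ := hγ.exists_ae_eq_comp hk
  exact ⟨ρ ⁻¹' {j}, hρ.preimage {j}⟩

variable [IsFiniteMeasure μ]

theorem Approximable.union (hA : Approximable G μ γ A) (hB : Approximable G μ γ B) :
    Approximable G μ γ (A ∪ B) := by
  classical
  intro θ hθ
  obtain ⟨F₁, h₁⟩ := hA (θ / 2) (half_pos hθ)
  obtain ⟨F₂, h₂⟩ := hB (θ / 2) (half_pos hθ)
  refine ⟨F₁ ∪ F₂, ?_⟩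
  filter_upwards [h₁, h₂] with n ⟨E₁, hE₁, hμ₁⟩ ⟨E₂, hE₂, hμ₂⟩
  refine ⟨E₁ ∪ E₂, fun w w' hw => congrArg₂ Or ?_ ?_, ?_⟩
  · exact hE₁ fun g hg => hw g (Finset.mem_union_left _ hg)
  · exact hE₂ fun g hg => hw g (Finset.mem_union_right _ hg)
  · exact (measureReal_mono Set.union_symmDiff_union_subset).trans
      ((measureReal_union_le _ _).trans ((add_le_add hμ₁ hμ₂).trans_eq (add_halves θ)))

theorem Approximable.of_forall_close
    (h : ∀ θ : ℝ, 0 < θ → ∃ B, Approximable G μ γ B ∧ μ.real (symmDiff A B) ≤ θ) :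
    Approximable G μ γ A := by
  intro θ hθ
  obtain ⟨B, hB, hAB⟩ := h (θ / 2) (half_pos hθ)
  obtain ⟨F, hF⟩ := hB (θ / 2) (half_pos hθ)
  refine ⟨F, hF.mono fun n ⟨E, hE, hμ⟩ => ⟨E, hE, ?_⟩⟩
  exact (measureReal_mono (symmDiff_triangle A B _)).trans
    ((measureReal_union_le _ _).trans ((add_le_add hAB hμ).trans_eq (add_halves θ)))

theorem Approximable.congr_ae (hB : Approximable G μ γ B) (h : A =ᵐ[μ] B) :
    Approximable G μ γ A :=
  .of_forall_close fun θ hθ =>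
    ⟨B, hB, by rw [measureReal_def, measure_symmDiff_eq_zero_iff.2 h]; exact hθ.le⟩

theorem Approximable.iUnion {A : ℕ → Set X} (hm : ∀ n, MeasurableSet (A n))
    (hA : ∀ n, Approximable G μ γ (A n)) : Approximable G μ γ (⋃ n, A n) := by
  have hacc (n : ℕ) : Approximable G μ γ (Set.accumulate A n) := by
    induction n with
    | zero => simpa using hA 0
    | succ n ih => exact Set.accumulate_succ A n ▸ ih.union (hA _)
  have hlim : Tendsto (fun n => μ.real (Set.accumulate A n)) atTop (𝓝 (μ.real (⋃ n, A n))) :=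
    (ENNReal.tendsto_toReal (measure_ne_top _ _)).comp tendsto_measure_iUnion_accumulate
  refine .of_forall_close fun θ hθ => ?_
  obtain ⟨n, hn⟩ := (hlim.eventually_const_lt (sub_lt_self _ hθ)).exists
  have hsub : Set.accumulate A n ⊆ ⋃ n, A n := Set.accumulate_subset_iUnion n
  refine ⟨_, hacc n, ?_⟩
  rw [symmDiff_of_ge hsub,
    measureReal_sdiff hsub (.biUnion (Set.to_countable _) fun k _ => hm k)]
  linarith

variable (G μ γ) in
/-- The σ-algebra of measurable approximable sets. -/
@[reducible]
def approximableSpace : MeasurableSpace X where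
  MeasurableSet' A := MeasurableSet A ∧ Approximable G μ γ A
  measurableSet_empty := ⟨.empty, approximable_empty⟩
  measurableSet_compl _ h := ⟨h.1.compl, h.2.compl⟩
  measurableSet_iUnion _ h :=
    ⟨.iUnion fun n => (h n).1, .iUnion (fun n => (h n).1) fun n => (h n).2⟩

theorem IsChain.approximable_atom (hγ : IsChain μ α u γ) (i : ℕ) :
    Approximable G μ γ (α.atom i) := by
  by_cases hi : μ (α.atom i) = 0
  · exact approximable_empty.congr_ae (ae_eq_empty.2 hi)
  obtain ⟨j, hj⟩ := hγ.exists_atom_ae_eq_iInter hi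
  refine Approximable.congr_ae ?_ hj
  exact (MeasurableSet.iInter (m := approximableSpace G μ γ) fun n =>
    ⟨(γ n).measurableSet_fiber (j n), hγ.approximable_chain_atom n (j n)⟩).2

theorem IsChain.approximable_of_refines (hγ : IsChain μ α u γ) {κ : Type*} {b : X → κ}
    (hb : Refines μ α.label b) (D : Set κ) : Approximable G μ γ (b ⁻¹' D) := by
  obtain ⟨ρ, hρ⟩ := hb.exists_ae_eq_comp
  have hD : MeasurableSet[approximableSpace G μ γ] (⋃ i ∈ ρ ⁻¹' D, α.atom i) :=
    .biUnion (Set.to_countable _) fun i _ => ⟨α.measurableSet_fiber i, hγ.approximable_atom i⟩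
  refine hD.2.congr_ae ?_
  simpa only [OrdPartition.atom, Set.biUnion_preimage_singleton, Set.preimage_comp] using
    hρ.preimage D

theorem IsChain.approximable_of_isGenerating [MeasurableConstSMul G X]
    [SMulInvariantMeasure G X μ] (hγ : IsChain μ α u γ) (hα : IsGenerating G μ α)
    (hA : MeasurableSet A) : Approximable G μ γ A := by
  obtain ⟨A', hA', hAA'⟩ := hα A hA
  have hle : invariantSigma G α.atom ≤ approximableSpace G μ γ :=
    invariantSigma_le (fun g s hs => ⟨hs.1.const_smul g, hs.2.smul g⟩)
      fun i => ⟨α.measurableSet_fiber i, hγ.approximable_atom i⟩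
  exact (hle _ hA').2.congr_ae (measure_symmDiff_eq_zero_iff.1 hAA')

theorem Approximable.exists_isApproxCode {k : ℕ} [NeZero k] {δ : OrdPartition X (Fin k)}
    (h : ∀ j, Approximable G μ γ (δ.atom j)) {θ : ℝ} (hθ : 0 < θ) :
    ∃ F : Finset G, ∀ᶠ n in atTop, ∃ c, IsApproxCode μ (γ n) c F δ.label θ := by
  classical
  have hk : (0 : ℝ) < k := by exact_mod_cast Nat.pos_of_neZero k
  choose F hF using fun j => h j (θ / k) (div_pos hθ hk)
  refine ⟨Finset.univ.biUnion F, (eventually_all.2 hF).mono fun n hn => ?_⟩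
  choose E hE hμ using hn
  obtain ⟨c, hc, hcE⟩ := exists_dependsOn_of_events E fun j => (hE j).mono
    (by exact_mod_cast Finset.subset_biUnion_of_mem F (Finset.mem_univ j))
  have hsub : {x | δ.label x ≠ c (itinerary G (γ n) x)} ⊆
      ⋃ j, symmDiff (δ.atom j) (itinerary G (γ n) ⁻¹' E j) := by
    refine fun x hx => by_contra fun hcon => hx (hcE _ _ fun j => ?_).symm
    have hj : x ∉ symmDiff (δ.atom j) (itinerary G (γ n) ⁻¹' E j) :=
      fun h => hcon (Set.mem_iUnion.2 ⟨j, h⟩)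
    rw [Set.mem_symmDiff, not_or, not_and_not_right, not_and_not_right] at hj
    exact ⟨fun h => (hj.2 h).symm, fun h => hj.1 h.symm⟩
  refine ⟨c, hc, (measureReal_mono hsub).trans ((measureReal_iUnion_fintype_le _).trans ?_)⟩
  refine (Finset.sum_le_card_nsmul _ _ _ fun j _ => hμ j).trans_eq ?_
  rw [Finset.card_univ, Fintype.card_fin, nsmul_eq_mul, mul_div_cancel₀ _ hk.ne']

end Approximable

section EntropyCauchy

variable {X : Type*} [MeasurableSpace X] {μ : Measure X}

/-- The partitions `γ n` form a Cauchy sequence for the Rokhlin metric in a one-sided sense: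
up to an arbitrarily small code length, some `γ n₀` determines all later `γ n`, each of which
refines it. -/
def IsEntropyCauchy (μ : Measure X) {u : ℕ → ℕ} (γ : ∀ n, OrdPartition X (Fin (u n))) : Prop :=
  ∀ κ : ℝ, 0 < κ → ∃ n₀, ∀ᶠ n in atTop, ∃ (π : Fin (u n) → Fin (u n₀)) (w : Fin (u n) → ℝ),
    (γ n₀).label = π ∘ (γ n).label ∧ IsFiberWeight μ (γ n) π w κ

theorem isEntropyCauchy_const {u : ℕ} (γ : OrdPartition X (Fin u)) :
    IsEntropyCauchy μ fun _ => γ := by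
  refine fun κ hκ => ⟨0, .of_forall fun _ => ⟨id, 1, rfl, fun _ => one_pos, fun j => ?_, ?_⟩⟩
  · simp [Finset.filter_eq', hκ.le]
  · simp [hκ.le]

theorem mul_neg_log_add_le_negMulLog {p c : ℝ} (hp : 0 ≤ p) (hc : 0 ≤ c) :
    p * -Real.log (p + c) ≤ Real.negMulLog p := by
  rcases hp.eq_or_lt with rfl | hp
  · simp
  · rw [Real.negMulLog, neg_mul_comm]
    gcongr
    exact le_add_of_nonneg_right hc

theorem sum_measureReal_atom_le_one [IsProbabilityMeasure μ] {u : ℕ} (γ : OrdPartition X (Fin u)) :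
    ∑ i, μ.real (γ.atom i) ≤ 1 :=
  (sum_measureReal_preimage_singleton Finset.univ fun i _ => γ.measurableSet_fiber i).trans_le
    measureReal_le_one

theorem sum_fiber_ite_le_exp {ι ρ : Type*} [Fintype ι] [DecidableEq ι] [DecidableEq ρ]
    {p : ι → ℝ} (hp : ∀ i, 0 ≤ p i) (hp1 : ∑ i, p i ≤ 1) {π : ι → ρ} {A : Finset ι}
    (hπ : ∀ i ∉ A, ∀ i', π i' = π i → i' = i) {κ : ℝ} (hκ : 0 ≤ κ) (j : ρ) :
    ∑ i with π i = j, (if i ∈ A then p i + κ / Fintype.card ι else 1) ≤ Real.exp κ := by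
  have hκ' : 0 ≤ κ / Fintype.card ι := div_nonneg hκ (Nat.cast_nonneg _)
  have hdiv : κ / Fintype.card ι * Fintype.card ι ≤ κ := by
    rcases eq_or_ne (Fintype.card ι : ℝ) 0 with h | h
    · simpa [h] using hκ
    · exact (div_mul_cancel₀ κ h).le
  by_cases hj : ∃ i ∉ A, π i = j
  · obtain ⟨i, hi, rfl⟩ := hj
    have hfiber : ({i' | π i' = π i} : Finset ι) = {i} := by
      ext i'
      simpa using ⟨hπ i hi i', fun h => h ▸ rfl⟩
    rw [hfiber, Finset.sum_singleton, if_neg hi]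
    exact Real.one_le_exp hκ
  · have hmem (i : ι) (hi : i ∈ ({i' | π i' = j} : Finset ι)) : i ∈ A :=
      by_contra fun h => hj ⟨i, h, (Finset.mem_filter.1 hi).2⟩
    calc ∑ i with π i = j, (if i ∈ A then p i + κ / Fintype.card ι else 1)
        = ∑ i with π i = j, (p i + κ / Fintype.card ι) :=
          Finset.sum_congr rfl fun i hi => if_pos (hmem i hi)
      _ ≤ ∑ i, (p i + κ / Fintype.card ι) :=
          Finset.sum_le_univ_sum_of_nonneg fun i => add_nonneg (hp i) hκ'
      _ = ∑ i, p i + κ / Fintype.card ι * Fintype.card ι := by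
          simp [Finset.sum_add_distrib, mul_comm]
      _ ≤ 1 + κ := add_le_add hp1 hdiv
      _ ≤ Real.exp κ := (add_comm _ _).trans_le (Real.add_one_le_exp κ)

/- The term `κ / u` keeps the weights of null atoms positive. -/
theorem exists_isFiberWeight_of_sum_negMulLog_le [IsProbabilityMeasure μ] {u l : ℕ}
    {γ : OrdPartition X (Fin u)} {π : Fin u → Fin l} {A : Finset (Fin u)}
    (hπ : ∀ i ∉ A, ∀ i', π i' = π i → i' = i) {κ : ℝ} (hκ : 0 < κ)
    (hA : ∑ i ∈ A, Real.negMulLog (μ.real (γ.atom i)) ≤ κ) :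
    ∃ w, IsFiberWeight μ γ π w κ := by
  have hκ' (i : Fin u) : 0 < κ / Fintype.card (Fin u) :=
    div_pos hκ (by rw [Fintype.card_fin]; exact_mod_cast i.pos)
  refine ⟨fun i => if i ∈ A then μ.real (γ.atom i) + κ / Fintype.card (Fin u) else 1,
    fun i => ?_, fun j => ?_, ?_⟩
  · split_ifs
    exacts [add_pos_of_nonneg_of_pos measureReal_nonneg (hκ' i), one_pos]
  · exact sum_fiber_ite_le_exp (fun _ => measureReal_nonneg) (sum_measureReal_atom_le_one γ)
      hπ hκ.le j
  · rw [← Finset.sum_subset A.subset_univ fun i _ hi => by simp [hi]]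
    refine (Finset.sum_le_sum fun i hi => ?_).trans hA
    rw [if_pos hi]
    exact mul_neg_log_add_le_negMulLog measureReal_nonneg (hκ' i).le

end EntropyCauchy

section Truncation

variable {X : Type*} [MeasurableSpace X] {μ : Measure X}

/-- The finite partition obtained from `α` by merging all atoms with index at least `N`. -/
def OrdPartition.truncation (α : OrdPartition X ℕ) (N : ℕ) : OrdPartition X (Fin (N + 1)) where
  label x := Fin.clamp (α.label x) N
  measurableSet_fiber i := α.measurable_label (t := {a | Fin.clamp a N = i}) trivial

theorem OrdPartition.coe_truncation_label (α : OrdPartition X ℕ) (N : ℕ) (x : X) :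
    ((α.truncation N).label x : ℕ) = min (α.label x) N :=
  Fin.coe_clamp _ _

theorem isChain_truncation (μ : Measure X) (α : OrdPartition X ℕ) {φ : ℕ → ℕ}
    (hφ : StrictMono φ) :
    IsChain μ α (fun n => φ n + 1) (fun n => α.truncation (φ n)) where
  mono n := .of_factorsThrough fun x y h => by
    have hlt := hφ (Nat.lt_add_one n)
    simp only [Fin.ext_iff, OrdPartition.coe_truncation_label] at h ⊢
    omega
  le n := .of_factorsThrough fun x y h => by
    rw [Fin.ext_iff, OrdPartition.coe_truncation_label, OrdPartition.coe_truncation_label, h]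
  join := .of_factorsThrough fun x y h => by
    have hxy := congrFun h (α.label x + α.label y + 1)
    have hlt := hφ.le_apply (x := α.label x + α.label y + 1)
    simp only [Fin.ext_iff, OrdPartition.coe_truncation_label] at hxy
    omega

theorem OrdPartition.truncation_atom_castSucc (α : OrdPartition X ℕ) {N : ℕ} (i : Fin N) :
    (α.truncation N).atom i.castSucc = α.atom i := by
  ext x
  have hi := i.isLt
  simp only [OrdPartition.atom, Set.mem_preimage, Set.mem_singleton_iff, Fin.ext_iff,
    OrdPartition.coe_truncation_label, Fin.val_castSucc]
  omega

theorem OrdPartition.truncation_atom_last (α : OrdPartition X ℕ) (N : ℕ) :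
    (α.truncation N).atom (Fin.last N) = {x | N ≤ α.label x} := by
  ext x
  simp [OrdPartition.atom, Fin.ext_iff, OrdPartition.coe_truncation_label]

theorem tendsto_measureReal_tail [IsFiniteMeasure μ] (α : OrdPartition X ℕ) :
    Tendsto (fun N => μ.real {x | N ≤ α.label x}) atTop (𝓝 0) := by
  have hempty : ⋂ N : ℕ, {x | N ≤ α.label x} = ∅ :=
    Set.eq_empty_of_forall_notMem fun x hx => (Set.mem_iInter.1 hx (α.label x + 1)).not_gt
      (Nat.lt_succ_self _)
  have hlim := tendsto_measure_iInter_atTop (μ := μ) (s := fun N : ℕ => {x | N ≤ α.label x})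
    (fun N => (α.measurable_label (measurableSet_Ici (a := N))).nullMeasurableSet)
    (fun _ _ hab _ hx => hab.trans hx) ⟨0, measure_ne_top _ _⟩
  rw [hempty, measure_empty] at hlim
  exact (ENNReal.tendsto_toReal ENNReal.zero_ne_top).comp hlim

variable [IsProbabilityMeasure μ] {α : OrdPartition X ℕ}

theorem summable_negMulLog_atom (h : shannonEntropy μ α < ⊤) :
    Summable fun i => Real.negMulLog (μ.real (α.atom i)) :=
  (ENNReal.summable_toReal h.ne).congr fun _ =>
    ENNReal.toReal_ofReal (Real.negMulLog_nonneg measureReal_nonneg measureReal_le_one)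

theorem exists_sum_negMulLog_truncation_le (h : shannonEntropy μ α < ⊤) {κ : ℝ} (hκ : 0 < κ) :
    ∃ N₀, ∀ N ≥ N₀,
      ∑ i : Fin (N + 1) with N₀ ≤ i.val,
        Real.negMulLog (μ.real ((α.truncation N).atom i)) ≤ κ := by
  have htail : ∀ᶠ N in atTop, Real.negMulLog (μ.real {x | N ≤ α.label x}) ≤ κ / 2 := by
    refine Tendsto.eventually_le_const (half_pos hκ) ?_
    exact (Real.continuous_negMulLog.tendsto' 0 0 Real.negMulLog_zero).comp
      (tendsto_measureReal_tail α)
  obtain ⟨s, hs⟩ :=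
    summable_iff_vanishing_norm.1 (summable_negMulLog_atom h) (κ / 2) (half_pos hκ)
  obtain ⟨M, hM⟩ := s.exists_nat_subset_range
  obtain ⟨N₀, hN₀, hMN₀⟩ :=
    ((eventually_forall_ge_atTop.2 htail).and (eventually_ge_atTop M)).exists
  refine ⟨N₀, fun N hN => ?_⟩
  have hdisj : Disjoint {i ∈ Finset.range N | N₀ ≤ i} s := by
    refine Finset.disjoint_left.2 fun i hi his => ?_
    have hlt := Finset.mem_range.1 (hM his)
    have hle := (Finset.mem_filter.1 hi).2
    omega
  have hinit := (le_abs_self _).trans (hs _ hdisj).le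
  rw [Finset.sum_filter, Fin.sum_univ_castSucc, ← add_halves κ]
  refine add_le_add ?_ ?_
  · simpa only [OrdPartition.truncation_atom_castSucc, Fin.val_castSucc, Finset.sum_filter,
      Fin.sum_univ_eq_sum_range (fun i => if N₀ ≤ i then Real.negMulLog (μ.real (α.atom i)) else 0)]
      using hinit
  · rw [Fin.val_last, if_pos hN, OrdPartition.truncation_atom_last]
    exact hN₀ N hN

theorem isEntropyCauchy_truncation (h : shannonEntropy μ α < ⊤) :
    IsEntropyCauchy μ α.truncation := by
  intro κ hκ
  obtain ⟨N₀, hN₀⟩ := exists_sum_negMulLog_truncation_le h hκ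
  refine ⟨N₀, (eventually_ge_atTop N₀).mono fun N hN => ?_⟩
  have hclamp : ∀ i ∉ ({i | N₀ ≤ i.val} : Finset (Fin (N + 1))), ∀ i' : Fin (N + 1),
      Fin.clamp i' N₀ = Fin.clamp i N₀ → i' = i := by
    intro i hi i' h
    simp only [Finset.mem_filter_univ, Fin.ext_iff, Fin.coe_clamp] at hi h ⊢
    omega
  obtain ⟨w, hw⟩ := exists_isFiberWeight_of_sum_negMulLog_le hclamp hκ (hN₀ N hN)
  refine ⟨_, w, funext fun x => Fin.ext ?_, hw⟩
  simp only [Function.comp_apply, Fin.coe_clamp, OrdPartition.coe_truncation_label]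
  omega

end Truncation

section Comparison

theorem eventually_mul_lt (a : ℝ) {h : ℝ} (hh : 0 < h) : ∀ᶠ c in 𝓝[>] (0 : ℝ), a * c < h :=
  (((continuous_const_mul a).tendsto' 0 0 (mul_zero a)).mono_left
    nhdsWithin_le_nhds).eventually_lt_const hh

theorem OrdPartition.neZero_of_isProbabilityMeasure {X : Type*} [MeasurableSpace X]
    (μ : Measure X) [IsProbabilityMeasure μ] {k : ℕ} (δ : OrdPartition X (Fin k)) : NeZero k := by
  obtain ⟨x⟩ := nonempty_of_isProbabilityMeasure μ
  exact ⟨fun h => (Fin.cast h (δ.label x)).elim0⟩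

variable {G : Type*} [Group G] {X : Type*} [MeasurableSpace X] [MulAction G X]
  [MeasurableConstSMul G X] {μ : Measure X} [IsProbabilityMeasure μ] [SMulInvariantMeasure G X μ]
  {S : MapSequence G} {u v : ℕ → ℕ} {γ : ∀ n, OrdPartition X (Fin (u n))}
  {δ : ∀ n, OrdPartition X (Fin (v n))}

theorem IsEntropyCauchy.exists_entropyFin_le (hγ : IsEntropyCauchy μ γ) (hS : S.IsAsymptoticHom)
    (hγδ : ∀ n j, Approximable G μ δ ((γ n).atom j))
    (hδγ : ∀ n j, Approximable G μ γ ((δ n).atom j)) {F : Finset G} {L : EReal}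
    (hL : Tendsto (fun n => entropyFin S μ (δ n) F) atTop (𝓝 L)) {z : ℝ} (hz : L < z) :
    ∃ T, ∀ᶠ N in atTop, entropyFin S μ (γ N) T ≤ z := by
  classical
  obtain ⟨z', hLz', hz'⟩ := EReal.lt_iff_exists_real_btwn.1 hz
  rw [EReal.coe_lt_coe_iff] at hz'
  obtain ⟨κ, hκ, hκz⟩ : ∃ κ : ℝ, 0 < κ ∧ 5 * κ < z - z' :=
    ⟨(z - z') / 6, by linarith, by linarith⟩
  obtain ⟨n₀, hn₀⟩ := hγ κ hκ
  obtain ⟨t, htκ, ht, ht1⟩ :=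
    ((eventually_mul_lt (u n₀) hκ).and (Ioc_mem_nhdsGT one_pos)).exists
  obtain ⟨θ', hθ'κ, hθ'⟩ := ((eventually_mul_lt (-Real.log t) hκ).and self_mem_nhdsWithin).exists
  have := (γ n₀).neZero_of_isProbabilityMeasure μ
  obtain ⟨F₂, hF₂⟩ := Approximable.exists_isApproxCode (hγδ n₀) hθ'
  obtain ⟨n, ⟨d, hd⟩, hn⟩ := (hF₂.and (hL.eventually_lt_const hLz')).exists
  obtain ⟨⟨ε, hε⟩, hnε⟩ := iInf_lt_iff.1 hn
  obtain ⟨θ, ⟨hθκ, hθε⟩, hθ⟩ := (((eventually_mul_lt (F₂.card * -Real.log t) hκ).and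
    (eventually_mul_lt (2 * F.card) hε)).and self_mem_nhdsWithin).exists
  have := (δ n).neZero_of_isProbabilityMeasure μ
  obtain ⟨F₁, hF₁⟩ := Approximable.exists_isApproxCode (hδγ n) hθ
  let T := insert 1 (F ∪ F₂ ∪ F₁)
  have hFT : F ∪ F₂ ∪ F₁ ⊆ T := Finset.subset_insert _ _
  refine ⟨T * T, (hn₀.and hF₁).mono fun N ⟨⟨π, w, hπ, hw⟩, c, hc⟩ => ?_⟩
  refine (hw.entropyFin_le (hc.mono (Finset.union_subset_right hFT)) (hπ ▸ hd)
    (Finset.union_subset_left (Finset.union_subset_left hFT))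
    (Finset.union_subset_right (Finset.union_subset_left hFT)) (Finset.mem_insert_self _ _)
    ht ht1 hS (ε := ε) (B := z - z') (by linarith) (by linarith)).trans ?_
  calc entropyFinEps S μ (δ n) F ε + ((z - z' : ℝ) : EReal)
      ≤ (z' : EReal) + ((z - z' : ℝ) : EReal) := by gcongr
    _ = (z : EReal) := by rw [← EReal.coe_add, add_sub_cancel]

theorem meanEntropy_le_of_isGenerating (hS : S.IsAsymptoticHom) {α β : OrdPartition X ℕ}
    (hα : IsGenerating G μ α) (hβ : IsGenerating G μ β) (hH : shannonEntropy μ α < ⊤) :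
    meanEntropy S μ α ≤ meanEntropy S μ β := by
  refine le_iInf fun F => le_sInf ?_
  rintro L ⟨v, δ, hδ, hL⟩
  refine EReal.le_of_forall_lt_iff_le.1 fun z hz => ?_
  obtain ⟨T, hT⟩ := (isEntropyCauchy_truncation hH).exists_entropyFin_le hS
    (fun N j => hδ.approximable_of_isGenerating hβ ((α.truncation N).measurableSet_fiber j))
    (fun n j => (isChain_truncation μ α strictMono_id).approximable_of_isGenerating hα
      ((δ n).measurableSet_fiber j)) hL hz
  obtain ⟨a, φ, hφ, ha⟩ := CompactSpace.tendsto_subseq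
    fun N => entropyFin S μ (α.truncation N) T
  calc meanEntropy S μ α ≤ entropyF S μ α T := iInf_le _ T
    _ ≤ a := sInf_le ⟨_, _, isChain_truncation μ α hφ, ha⟩
    _ ≤ z := le_of_tendsto ha (hφ.tendsto_atTop.eventually hT)

theorem isChain_const {u : ℕ} (α : OrdPartition X (Fin u)) :
    IsChain μ α.toNat (fun _ => u) (fun _ => α) := by
  have := α.neZero_of_isProbabilityMeasure μ
  exact ⟨fun _ => .of_factorsThrough fun _ _ h => h, fun _ => .of_factorsThrough fun _ _ => Fin.ext,
    .of_factorsThrough fun _ _ h => congrArg Fin.val (congrFun h 0)⟩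

theorem OrdPartition.toNat_atom {u : ℕ} (α : OrdPartition X (Fin u)) (j : Fin u) :
    α.toNat.atom j = α.atom j := by
  ext x
  simp [OrdPartition.atom, OrdPartition.toNat, Fin.ext_iff]

theorem meanEntropyFin_eq (hS : S.IsAsymptoticHom) {u : ℕ} (α : OrdPartition X (Fin u)) :
    meanEntropyFin S μ α = meanEntropy S μ α.toNat := by
  refine le_antisymm (le_iInf fun F => le_sInf ?_) (le_iInf fun F => (iInf_le _ F).trans
    (sInf_le ⟨_, _, isChain_const α, tendsto_const_nhds⟩))
  rintro L ⟨v, δ, hδ, hL⟩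
  refine EReal.le_of_forall_lt_iff_le.1 fun z hz => ?_
  obtain ⟨T, hT⟩ := (isEntropyCauchy_const α).exists_entropyFin_le hS
    (fun _ j => α.toNat_atom j ▸ hδ.approximable_atom j)
    (fun n j => (isChain_const α).approximable_of_refines (hδ.le n) {j}) hL hz
  obtain ⟨_, hle⟩ := hT.exists
  exact (iInf_le _ T).trans hle

theorem systemEntropy_eq (hS : S.IsAsymptoticHom) {α : OrdPartition X ℕ}
    (hα : IsGenerating G μ α) (hH : shannonEntropy μ α < ⊤) :
    systemEntropy S μ = some (meanEntropy S μ α) := by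
  have h : ∃ α : OrdPartition X ℕ, IsGenerating G μ α ∧ shannonEntropy μ α < ⊤ := ⟨α, hα, hH⟩
  rw [systemEntropy, dif_pos h]
  exact congrArg some <| le_antisymm
    (meanEntropy_le_of_isGenerating hS h.choose_spec.1 hα h.choose_spec.2)
    (meanEntropy_le_of_isGenerating hS hα h.choose_spec.1 hH)

end Comparison

section Conjugacy

variable {G : Type*} [Group G] {X Y : Type*} [MeasurableSpace X] [MulAction G X]
  [MeasurableSpace Y] [MulAction G Y] {μ : Measure X} {ν : Measure Y} {X' : Set X} {Y' : Set Y}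
  {φ : X' ≃ᵐ Y'} {A : Set X} {B : Set Y}

variable (G μ ν) in
/-- `φ` is a measure conjugacy from `(G, X, μ)` to `(G, Y, ν)` defined between conull sets. -/
structure IsConjugacy (φ : X' ≃ᵐ Y') : Prop where
  measure_compl_source : μ X'ᶜ = 0
  measure_compl_target : ν Y'ᶜ = 0
  measure_image : ∀ B : Set Y, MeasurableSet B →
    μ (Subtype.val '' {x : X' | (φ x : Y) ∈ B}) = ν B
  map_smul : ∀ (g : G) (x : X'),
    ∃ hx : g • (x : X) ∈ X', (φ ⟨g • (x : X), hx⟩ : Y) = g • (φ x : Y)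

theorem MeasurablyConjugate.exists_isConjugacy (h : MeasurablyConjugate G μ ν) :
    ∃ (X' : Set X) (Y' : Set Y) (φ : X' ≃ᵐ Y'), IsConjugacy G μ ν φ :=
  let ⟨X', Y', φ, hX, hY, himage, hsmul⟩ := h
  ⟨X', Y', φ, hX, hY, himage, hsmul⟩

/-- `A` and `B` correspond to each other under the partially defined map `φ`. -/
def Corresponds (φ : X' ≃ᵐ Y') (A : Set X) (B : Set Y) : Prop :=
  ∀ x : X', (x : X) ∈ A ↔ (φ x : Y) ∈ B

theorem exists_corresponds (φ : X' ≃ᵐ Y') (hA : MeasurableSet A) :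
    ∃ B, MeasurableSet B ∧ Corresponds φ A B := by
  obtain ⟨B, hB, hAB⟩ := (measurable_subtype_coe.comp φ.symm.measurable) hA
  refine ⟨B, hB, fun x => ?_⟩
  simpa using (Set.ext_iff.1 hAB (φ x)).symm

theorem corresponds_preimage {ι : Type*} {a : X → ι} {b : Y → ι} (h : ∀ x : X', a x = b (φ x))
    (D : Set ι) : Corresponds φ (a ⁻¹' D) (b ⁻¹' D) := fun x => by
  rw [Set.mem_preimage, Set.mem_preimage, h]

theorem Corresponds.symm (h : Corresponds φ A B) : Corresponds φ.symm B A := fun y => by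
  simpa using (h (φ.symm y)).symm

theorem Corresponds.iInter {ι : Sort*} {A : ι → Set X} {B : ι → Set Y}
    (h : ∀ i, Corresponds φ (A i) (B i)) : Corresponds φ (⋂ i, A i) (⋂ i, B i) := fun x => by
  simpa only [Set.mem_iInter] using forall_congr' fun i => h i x

theorem Corresponds.sdiff {A' : Set X} {B' : Set Y} (h : Corresponds φ A B)
    (h' : Corresponds φ A' B') : Corresponds φ (A \ A') (B \ B') :=
  fun x => and_congr (h x) (not_congr (h' x))

theorem Corresponds.symmDiff {A' : Set X} {B' : Set Y} (h : Corresponds φ A B)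
    (h' : Corresponds φ A' B') : Corresponds φ (symmDiff A A') (symmDiff B B') :=
  fun x => or_congr (h.sdiff h' x) (h'.sdiff h x)

theorem Corresponds.image_inter_eq (h : Corresponds φ A B) :
    Subtype.val '' {x : X' | (φ x : Y) ∈ B} = A ∩ X' := by
  ext x
  simp only [Set.mem_image, Set.mem_ofPred_eq, ← h _, Subtype.exists, exists_and_left,
    exists_prop, exists_eq_right_right, Set.mem_inter_iff]

theorem IsConjugacy.measure_eq (hφ : IsConjugacy G μ ν φ) (h : Corresponds φ A B)
    (hB : MeasurableSet B) : μ A = ν B := by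
  rw [← hφ.measure_image B hB, h.image_inter_eq, measure_inter_conull hφ.measure_compl_source]

theorem IsConjugacy.corresponds_smul (hφ : IsConjugacy G μ ν φ) (h : Corresponds φ A B) (g : G) :
    Corresponds φ (g • A) (g • B) := by
  intro x
  obtain ⟨hx, hgx⟩ := hφ.map_smul g⁻¹ x
  rw [Set.mem_smul_set_iff_inv_smul_mem, Set.mem_smul_set_iff_inv_smul_mem, ← hgx]
  exact h ⟨_, hx⟩

theorem IsConjugacy.symm (hφ : IsConjugacy G μ ν φ) : IsConjugacy G ν μ φ.symm where
  measure_compl_source := hφ.measure_compl_target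
  measure_compl_target := hφ.measure_compl_source
  measure_image A hA := by
    obtain ⟨B, hB, hAB⟩ := exists_corresponds φ hA
    rw [hAB.symm.image_inter_eq, measure_inter_conull hφ.measure_compl_target,
      hφ.measure_eq hAB hB]
  map_smul g y := by
    obtain ⟨hx, hgx⟩ := hφ.map_smul g (φ.symm y)
    rw [φ.apply_symm_apply] at hgx
    have hy : g • (y : Y) ∈ Y' := hgx ▸ (φ _).2
    have hgy : (⟨g • (y : Y), hy⟩ : Y') = φ ⟨g • (φ.symm y : X), hx⟩ := Subtype.ext hgx.symm
    exact ⟨hy, by rw [hgy, φ.symm_apply_apply]⟩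

theorem exists_partition_label_eq (φ : X' ≃ᵐ Y') {ι : Type*} [Countable ι] [Nonempty ι]
    (β : OrdPartition Y ι) :
    ∃ α : OrdPartition X ι, ∀ x : X', α.label x = β.label (φ x) := by
  let _ : MeasurableSpace ι := ⊤
  have hβ : Measurable fun x : X' => β.label (φ x) :=
    β.measurable_label.comp (measurable_subtype_coe.comp φ.measurable)
  obtain ⟨a, ha, hφ⟩ := hβ.exists_eq_measurable_comp
  exact ⟨⟨a, fun i => ha trivial⟩, fun x => (congrFun hφ x).symm⟩

theorem IsConjugacy.refines (hφ : IsConjugacy G μ ν φ) {ι κ : Type*} {a : X → ι} {a' : Y → ι}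
    {b : X → κ} {b' : Y → κ} (ha : ∀ x : X', a x = a' (φ x)) (hb : ∀ x : X', b x = b' (φ x))
    (ha' : ∀ i, MeasurableSet (a' ⁻¹' {i})) (hb' : ∀ j, MeasurableSet (b' ⁻¹' {j}))
    (h : Refines ν a' b') : Refines μ a b := fun i =>
  (h i).imp fun j hj => (hφ.measure_eq ((corresponds_preimage ha {i}).sdiff
    (corresponds_preimage hb {j})) ((ha' i).diff (hb' j))).trans hj

variable {α : OrdPartition X ℕ} {β : OrdPartition Y ℕ}

theorem IsConjugacy.shannonEntropy_eq (hφ : IsConjugacy G μ ν φ)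
    (hαβ : ∀ x : X', α.label x = β.label (φ x)) : shannonEntropy μ α = shannonEntropy ν β :=
  tsum_congr fun i => by
    rw [measureReal_def, measureReal_def, OrdPartition.atom, OrdPartition.atom,
      hφ.measure_eq (corresponds_preimage hαβ {i}) (β.measurableSet_fiber i)]

theorem IsConjugacy.isChain (hφ : IsConjugacy G μ ν φ)
    (hαβ : ∀ x : X', α.label x = β.label (φ x)) {u : ℕ → ℕ} {γ : ∀ n, OrdPartition X (Fin (u n))}
    {δ : ∀ n, OrdPartition Y (Fin (u n))} (hγδ : ∀ n (x : X'), (γ n).label x = (δ n).label (φ x))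
    (hδ : IsChain ν β u δ) : IsChain μ α u γ where
  mono n := hφ.refines (hγδ _) (hγδ _) (δ _).measurableSet_fiber (δ _).measurableSet_fiber
    (hδ.mono n)
  le n := hφ.refines hαβ (hγδ _) β.measurableSet_fiber (δ _).measurableSet_fiber (hδ.le n)
  join := hφ.refines (fun x => funext fun n => hγδ n x) hαβ
    (fun _ => measurable_pi_lambda _ (fun n => (δ n).measurable_label) (measurableSet_singleton _))
    β.measurableSet_fiber hδ.join

variable [MeasurableConstSMul G Y]

theorem IsConjugacy.isGenerating (hφ : IsConjugacy G μ ν φ)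
    (hαβ : ∀ x : X', α.label x = β.label (φ x)) (hβ : IsGenerating G ν β) :
    IsGenerating G μ α := by
  intro A hA
  obtain ⟨B, hB, hAB⟩ := exists_corresponds φ hA
  obtain ⟨B', hB', hBB'⟩ := hβ B hB
  have hle : invariantSigma G β.atom ≤
      ((invariantSigma G α.atom).comap (Subtype.val : X' → X)).map fun x => (φ x : Y) := by
    refine invariantSigma_le ?_ fun i => ?_
    · rintro g B ⟨A, hA, hAB⟩
      exact ⟨g • A, measurableSet_invariantSigma_smul hA g,
        Set.ext (hφ.corresponds_smul (Set.ext_iff.1 hAB) g)⟩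
    · exact ⟨α.atom i, measurableSet_invariantSigma i, Set.ext (corresponds_preimage hαβ {i})⟩
  obtain ⟨A', hA', hAB'⟩ := hle B' hB'
  have hBm : MeasurableSet B' :=
    invariantSigma_le (fun g _ hs => hs.const_smul g) β.measurableSet_fiber _ hB'
  exact ⟨A', hA', (hφ.measure_eq (hAB.symmDiff (Set.ext_iff.1 hAB')) (hB.symmDiff hBm)).trans hBB'⟩

theorem IsConjugacy.entropyFin_eq (hφ : IsConjugacy G μ ν φ) (S : MapSequence G) {u : ℕ}
    {γ : OrdPartition X (Fin u)} {δ : OrdPartition Y (Fin u)}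
    (hγδ : ∀ x : X', γ.label x = δ.label (φ x)) (F : Finset G) :
    entropyFin S μ γ F = entropyFin S ν δ F := by
  have h (ψ : F → Fin u) : μ.real (⋂ f : F, (f : G) • γ.atom (ψ f)) =
      ν.real (⋂ f : F, (f : G) • δ.atom (ψ f)) :=
    congrArg ENNReal.toReal <| hφ.measure_eq
      (.iInter fun f => hφ.corresponds_smul (corresponds_preimage hγδ {ψ f}) f)
      (.iInter fun f => (δ.measurableSet_fiber (ψ f)).const_smul (f : G))
  simp only [entropyFin, entropyFinEps, approxPartitions, distF, h]

variable [IsProbabilityMeasure ν]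

theorem IsConjugacy.meanEntropy_le (hφ : IsConjugacy G μ ν φ) (S : MapSequence G)
    (hαβ : ∀ x : X', α.label x = β.label (φ x)) : meanEntropy S μ α ≤ meanEntropy S ν β := by
  refine le_iInf fun F => (iInf_le _ F).trans (sInf_le_sInf ?_)
  rintro L ⟨u, δ, hδ, hL⟩
  have (n : ℕ) : NeZero (u n) := (δ n).neZero_of_isProbabilityMeasure ν
  choose γ hγ using fun n => exists_partition_label_eq φ (δ n)
  refine ⟨u, γ, hφ.isChain hαβ hγ hδ, ?_⟩
  simpa only [hφ.entropyFin_eq S (hγ _)] using hL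

variable [MeasurableConstSMul G X] [IsProbabilityMeasure μ]

theorem IsConjugacy.exists_isGenerating_meanEntropy_eq (hφ : IsConjugacy G μ ν φ)
    (S : MapSequence G) (hβ : IsGenerating G ν β) (hH : shannonEntropy ν β < ⊤) :
    ∃ α : OrdPartition X ℕ, IsGenerating G μ α ∧ shannonEntropy μ α < ⊤ ∧
      meanEntropy S μ α = meanEntropy S ν β := by
  obtain ⟨α, hαβ⟩ := exists_partition_label_eq φ β
  refine ⟨α, hφ.isGenerating hαβ hβ, (hφ.shannonEntropy_eq hαβ).trans_lt hH,
    (hφ.meanEntropy_le S hαβ).antisymm (hφ.symm.meanEntropy_le S fun y => ?_)⟩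
  rw [hαβ, φ.apply_symm_apply]

theorem MeasurablyConjugate.systemEntropy_eq [SMulInvariantMeasure G X μ]
    [SMulInvariantMeasure G Y ν] {S : MapSequence G} (hS : S.IsAsymptoticHom)
    (h : MeasurablyConjugate G μ ν) : systemEntropy S μ = systemEntropy S ν := by
  obtain ⟨X', Y', φ, hφ⟩ := h.exists_isConjugacy
  by_cases hν : ∃ β : OrdPartition Y ℕ, IsGenerating G ν β ∧ shannonEntropy ν β < ⊤
  · obtain ⟨β, hβ, hHβ⟩ := hν
    obtain ⟨α, hα, hHα, heq⟩ := hφ.exists_isGenerating_meanEntropy_eq S hβ hHβ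
    rw [SoficEntropy.systemEntropy_eq hS hα hHα, SoficEntropy.systemEntropy_eq hS hβ hHβ, heq]
  · have hμ : ¬∃ α : OrdPartition X ℕ, IsGenerating G μ α ∧ shannonEntropy μ α < ⊤ := by
      rintro ⟨α, hα, hHα⟩
      obtain ⟨β, hβ, hHβ, -⟩ := hφ.symm.exists_isGenerating_meanEntropy_eq S hα hHα
      exact hν ⟨β, hβ, hHβ⟩
    rw [systemEntropy, dif_neg hμ, systemEntropy, dif_neg hν]

end Conjugacy

end SoficEntropy

theorem theorem2_general {G : Type*} [Group G]
    (S : SoficEntropy.MapSequence G) (hS : S.IsAsymptoticHom)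
    {X : Type*} [MeasurableSpace X] [MulAction G X] [MeasurableConstSMul G X]
    (μ : MeasureTheory.Measure X) [MeasureTheory.IsProbabilityMeasure μ]
    [MeasureTheory.SMulInvariantMeasure G X μ] :
    (∀ α β : SoficEntropy.OrdPartition X ℕ,
      SoficEntropy.IsGenerating G μ α → SoficEntropy.IsGenerating G μ β →
      SoficEntropy.shannonEntropy μ α + SoficEntropy.shannonEntropy μ β < ⊤ →
      SoficEntropy.meanEntropy S μ α = SoficEntropy.meanEntropy S μ β) ∧
    (∀ (u : ℕ) (α : SoficEntropy.OrdPartition X (Fin u)),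
      SoficEntropy.meanEntropyFin S μ α = SoficEntropy.meanEntropy S μ α.toNat) ∧
    (∀ α : SoficEntropy.OrdPartition X ℕ,
      SoficEntropy.IsGenerating G μ α → SoficEntropy.shannonEntropy μ α < ⊤ →
      SoficEntropy.systemEntropy S μ = some (SoficEntropy.meanEntropy S μ α)) ∧
    (∀ {Y : Type*} [MeasurableSpace Y] [MulAction G Y] [MeasurableConstSMul G Y]
      (ν : MeasureTheory.Measure Y) [MeasureTheory.IsProbabilityMeasure ν]
      [MeasureTheory.SMulInvariantMeasure G Y ν],
      SoficEntropy.MeasurablyConjugate G μ ν →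
      SoficEntropy.systemEntropy S μ = SoficEntropy.systemEntropy S ν) := by
  refine ⟨fun α β hα hβ hH => ?_, fun u α => SoficEntropy.meanEntropyFin_eq hS α,
    fun α hα hH => SoficEntropy.systemEntropy_eq hS hα hH,
    fun ν _ _ h => h.systemEntropy_eq hS⟩
  rw [ENNReal.add_lt_top] at hH
  exact le_antisymm (SoficEntropy.meanEntropy_le_of_isGenerating hS hα hβ hH.1)
    (SoficEntropy.meanEntropy_le_of_isGenerating hS hβ hα hH.2)

theorem theorem2 {G : Type*} [Group G] [Countable G]
    (S : SoficEntropy.MapSequence G) (hS : S.IsSoficApproximation)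
    {X : Type*} [MeasurableSpace X] [MulAction G X] [MeasurableConstSMul G X]
    (μ : MeasureTheory.Measure X) [MeasureTheory.IsProbabilityMeasure μ]
    [MeasureTheory.SMulInvariantMeasure G X μ] :
    -- the mean entropy does not depend on the generating partition
    (∀ α β : SoficEntropy.OrdPartition X ℕ,
      SoficEntropy.IsGenerating G μ α → SoficEntropy.IsGenerating G μ β →
      SoficEntropy.shannonEntropy μ α + SoficEntropy.shannonEntropy μ β < ⊤ →
      SoficEntropy.meanEntropy S μ α = SoficEntropy.meanEntropy S μ β) ∧
    -- for finite partitions the direct definition of the mean entropy gives the same value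
    (∀ (u : ℕ) (α : SoficEntropy.OrdPartition X (Fin u)),
      SoficEntropy.meanEntropyFin S μ α = SoficEntropy.meanEntropy S μ α.toNat) ∧
    -- so the entropy of the system is the mean entropy of any such partition
    (∀ α : SoficEntropy.OrdPartition X ℕ,
      SoficEntropy.IsGenerating G μ α → SoficEntropy.shannonEntropy μ α < ⊤ →
      SoficEntropy.systemEntropy S μ = some (SoficEntropy.meanEntropy S μ α)) ∧
    -- and it is invariant under measure conjugacy
    (∀ {Y : Type*} [MeasurableSpace Y] [MulAction G Y] [MeasurableConstSMul G Y]
      (ν : MeasureTheory.Measure Y) [MeasureTheory.IsProbabilityMeasure ν]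
      [MeasureTheory.SMulInvariantMeasure G Y ν],
      SoficEntropy.MeasurablyConjugate G μ ν →
      SoficEntropy.systemEntropy S μ = SoficEntropy.systemEntropy S ν) :=
  theorem2_general S hS.isAsymptoticHom μ
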